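/- Let $\mu$ be a partition of $n$, with diagram drawn in French notation (the largest row $\mu_1$ at the bottom), let $\mu'$ be its conjugate and $r$ its length. For a cell $u$ let $\operatorname{arm}(u)$ be the number of cells to the right of $u$ in its row, $\operatorname{leg}(u)$ the number of cells above $u$ in its column, and put $n(\mu)=\sum_i (i-1)\mu_i$. Label the cells by $1,\dots,n$ in reading order (rows from top to bottom, each row from left to right). Let $G_\mu$ be the graph on $\{1,\dots,n\}$ whose edges join two cells that lie in the same row, or that lie in consecutive rows with the cell of the lower row strictly to the left of the cell of the upper row. Let $G_\mu^+$ be $G_\mu$ together with the edges joining each cell $u$ outside the bottom row to the cell $\mathrm{South}(u)$ just below it; such an edge is identified with its upper cell $u$. In the degree $n$ component of $\mathbf{WQSym}$ (over a field $K$) let $\mathbf M_u$ be the sum of all words with packed word $u$, and for a packed word $u$ let $\Phi_u=\sum_v\mathbf M_v$ over the packed words $v$ finer than $u$ with the same standardization as $u$. Let $\omega$ be the linear map $\omega\mathbf M_u=(-1)^{n-\max(u)}\sum_{v\le u}\mathbf M_v$, the sum being over the packed words $v$ obtained by merging adjacent blocks of the set composition encoded by $u$. For a graph $H$ on $\{1,\dots,n\}$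 with $e(H)$ edges let $\mathbf{LLT}_H(A;q)=\sum_u q^{\operatorname{asc}_H(u)}\mathbf M_u$, where $\operatorname{asc}_H(u)$ is the number of edges $i<j$ of $H$ with $u_i<u_j$, and $\widetilde{\mathbf{LLT}}_H(A;q)=q^{e(H)}\mathbf{LLT}_H(A;q^{-1})$. Let $q\in K\setminus\{0,1\}$ and $t_1,t_2,\dots\in K$ (for instance, indeterminates). The multi-$t$ noncommutative Macdonald function is $$\mathbf H_\mu(A;q,t_1,\dots,t_{r-1})=\frac{q^{-n(\mu')+\binom{\mu_1}{2}}}{(q-1)^{n-\mu_1}}\sum_{G_\mu\subseteq H\subseteq G_\mu^+}\ \prod_{u\in H\setminus G_\mu}\bigl(1-t_{1+\operatorname{leg}(u)}q^{\operatorname{arm}(u)}\bigr)\prod_{u\in G_\mu^+\setminus H}\bigl(t_{1+\operatorname{leg}(u)}q^{\operatorname{arm}(u)+1}-1\bigr)\,\omega\widetilde{\mathbf{LLT}}_H(A;q).$$ For $\sigma\in\mathfrak S_n$, fill the cell with label $a$ with $\sigma(a)$. Let $\operatorname{Inv}(\sigma,\mu)$ be the number of edges $a<b$ of $G_\mu$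 with $\sigma(a)>\sigma(b)$, let $\operatorname{Des}(\sigma,\mu)$ (resp. $\operatorname{Asc}(\sigma,\mu)$) be the set of cells $u$ outside the bottom row whose entry is larger (resp. smaller) than the entry of $\mathrm{South}(u)$, and let $\min(\sigma)$ be the coarsest packed word with standardization $\sigma$. **Proposition.** $$\mathbf H_\mu(A;q,t_1,\dots,t_{r-1})=\sum_{\sigma\in\mathfrak S_n} q^{\operatorname{Inv}(\sigma,\mu)}\prod_{u\in\operatorname{Asc}(\sigma,\mu)}t_{1+\operatorname{leg}(u)}\prod_{u\in\operatorname{Des}(\sigma,\mu)}q^{-\operatorname{arm}(u)}\;\Phi_{\min(\sigma)}.$$ In particular, every coefficient on the $\Phi$-basis is zero or a single monomial: $(\Phi_u)_u$ is a basis of the degree $n$ component; the coefficient of $\Phi_{\min(\sigma)}$ is $q^{e}\prod_{i=1}^{r-1}t_i^{b_i}$, where $e=\operatorname{Inv}(\sigma,\mu)-\sum_{u\in\operatorname{Des}(\sigma,\mu)}\operatorname{arm}(u)\ge 0$ and $b_i=\#\{u\in\operatorname{Asc}(\sigma,\mu): 1+\operatorname{leg}(u)=i\}$; and the coefficient of $\Phi_u$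 is $0$ if $u$ is not of the form $\min(\sigma)$. -/

import Mathlib

namespace NCMacdonald

open Finset

/-! ### Words and packed words

A word of length `n` over the ordered alphabet `ℕ` is a function `Fin n → ℕ`. -/

/-- The packed word of a word `w`: the `k`-th smallest letter occurring in `w` is replaced
by `k` (with `k = 1, 2, …`). -/
def pack {n : ℕ} (w : Fin n → ℕ) : Fin n → ℕ :=
  fun i => ((univ.image w).filter (fun x => x ≤ w i)).card

/-- The largest letter of a word (`0` for the empty word). -/
def maxLetter {n : ℕ} (w : Fin n → ℕ) : ℕ := univ.sup w

/-- A word is packed if the set of its letters is `{1, …, m}` for some `m ≥ 0`. -/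
def IsPacked {n : ℕ} (u : Fin n → ℕ) : Prop := univ.image u = Icc 1 (maxLetter u)

/-- Packed words of length `n`. They encode the set compositions of the `n` positions. -/
abbrev PackedWord (n : ℕ) : Type := {u : Fin n → ℕ // IsPacked u}

theorem IsPacked.le {n : ℕ} {u : Fin n → ℕ} (hu : IsPacked u) (i : Fin n) : u i ≤ n := by
  have h1 : u i ≤ maxLetter u := Finset.le_sup (f := u) (mem_univ i)
  have h2 : (univ.image u).card = maxLetter u := by
    rw [hu]; simp
  have h3 : (univ.image u).card ≤ n := by
    simpa using (Finset.card_image_le (s := (univ : Finset (Fin n))) (f := u))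
  omega

noncomputable instance instFintypePackedWord (n : ℕ) : Fintype (PackedWord n) :=
  Fintype.ofInjective
    (fun u : PackedWord n => fun i => (⟨u.1 i, Nat.lt_succ_of_le (u.2.le i)⟩ : Fin (n + 1)))
    (by
      intro u v h
      apply Subtype.ext
      funext i
      have := congrFun h i
      simpa using this)

/-- The refinement order: `Coarser v u` says that the set composition encoded by `v` is obtained
by merging adjacent blocks of the one encoded by `u` (`v ≤ u`, `u` is finer than `v`). -/
def Coarser {n : ℕ} (v u : Fin n → ℕ) : Prop := ∀ i j, u i ≤ u j → v i ≤ v j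

/-- The standardization of a word: the letters are relabelled `1, …, n` in increasing order,
equal letters being numbered from left to right. -/
def std {n : ℕ} (w : Fin n → ℕ) : Fin n → ℕ :=
  fun i => (univ.filter (fun j => w j < w i ∨ (w j = w i ∧ j ≤ i))).card

/-- The letters of the minimal destandardization of a permutation `σ` (regarded as the word
`σ(1) ⋯ σ(n)`): the values are scanned in increasing order, starting with the letter `1`, and the
letter is increased by one exactly when the next value stands to the left of the previous one. -/
def minDestdWord {n : ℕ} (σ : Equiv.Perm (Fin n)) : Fin n → ℕ :=
  fun i => 1 + (univ.filter (fun a : Fin n =>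
    ∃ b : Fin n, (σ b : ℕ) = (σ a : ℕ) + 1 ∧ b < a ∧ σ b ≤ σ i)).card

theorem isPacked_minDestdWord {n : ℕ} (σ : Equiv.Perm (Fin n)) :
    IsPacked (minDestdWord σ) := by
  classical
  set g : ℕ → ℕ := fun k => 1 + (univ.filter (fun a : Fin n =>
    ∃ b : Fin n, (σ b : ℕ) = (σ a : ℕ) + 1 ∧ b < a ∧ (σ b : ℕ) ≤ k)).card with hg
  have hgw : ∀ i, minDestdWord σ i = g (σ i) := fun i => rfl
  have g0 : g 0 = 1 := by
    simp only [hg, Nat.add_eq_left, card_eq_zero, filter_eq_empty_iff]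
    rintro a - ⟨b, h1, -, h3⟩
    omega
  have gs : ∀ k, g (k + 1) ≤ g k + 1 := by
    intro k
    have hsub : (univ.filter (fun a : Fin n =>
        ∃ b : Fin n, (σ b : ℕ) = (σ a : ℕ) + 1 ∧ b < a ∧ (σ b : ℕ) ≤ k + 1)) ⊆
        (univ.filter (fun a : Fin n =>
          ∃ b : Fin n, (σ b : ℕ) = (σ a : ℕ) + 1 ∧ b < a ∧ (σ b : ℕ) ≤ k)) ∪
        (univ.filter (fun a : Fin n => (σ a : ℕ) = k)) := by
      intro a
      simp only [mem_union, mem_filter, mem_univ, true_and]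
      rintro ⟨b, h1, h2, h3⟩
      by_cases h : (σ b : ℕ) ≤ k
      · exact Or.inl ⟨b, h1, h2, h⟩
      · right; omega
    have h1 : (univ.filter (fun a : Fin n => (σ a : ℕ) = k)).card ≤ 1 := by
      rw [card_le_one]
      intro a ha b hb
      simp only [mem_filter, mem_univ, true_and] at ha hb
      exact σ.injective (Fin.ext (ha.trans hb.symm))
    have h2 := (card_le_card hsub).trans (card_union_le _ _)
    simp only [hg]
    omega
  have surj : ∀ k y, 1 ≤ y → y ≤ g k → ∃ k' ≤ k, g k' = y := by
    intro k
    induction k with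
    | zero =>
      intro y h1 h2
      exact ⟨0, le_rfl, by omega⟩
    | succ k ih =>
      intro y h1 h2
      by_cases h : y ≤ g k
      · obtain ⟨k', hk', e⟩ := ih y h1 h
        exact ⟨k', by omega, e⟩
      · have := gs k
        exact ⟨k + 1, le_rfl, by omega⟩
  ext y
  simp only [mem_image, mem_univ, true_and, mem_Icc]
  constructor
  · rintro ⟨i, rfl⟩
    refine ⟨?_, Finset.le_sup (f := minDestdWord σ) (mem_univ i)⟩
    simp [minDestdWord]
  · rintro ⟨h1, h2⟩
    have h2' : y ≤ univ.sup (minDestdWord σ) := h2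
    obtain ⟨i, -, hi⟩ := (Finset.le_sup_iff (show (⊥ : ℕ) < y from h1)).1 h2'
    rw [hgw] at hi
    obtain ⟨k', hk', e⟩ := surj _ _ h1 hi
    refine ⟨σ.symm ⟨k', lt_of_le_of_lt hk' (σ i).2⟩, ?_⟩
    rw [hgw]
    simpa using e

/-- The minimal destandardization `min(σ)`: the coarsest packed word with standardization `σ`. -/
def minDestd {n : ℕ} (σ : Equiv.Perm (Fin n)) : PackedWord n :=
  ⟨minDestdWord σ, isPacked_minDestdWord σ⟩

/-! ### The homogeneous component of degree `n` of `WQSym` -/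

section WQSym

variable (K : Type*) [Field K]

/-- The homogeneous component of degree `n` of the algebra of quasi-symmetric functions in
noncommuting variables. A homogeneous noncommutative formal series of degree `n` is identified
with the function mapping a word of length `n` to its coefficient; it belongs to `WQSym` if this
coefficient depends only on the packed word of the word. -/
def WQSym (n : ℕ) : Submodule K ((Fin n → ℕ) → K) where
  carrier := {f | ∀ w w', pack w = pack w' → f w = f w'}
  add_mem' := by
    intro f g hf hg w w' h
    simp [hf w w' h, hg w w' h]
  zero_mem' := by
    intro w w' _
    rfl
  smul_mem' := by
    intro c f hf w w' h
    simp [hf w w' h]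

/-- The monomial element `M_u`: the sum of all words `w` whose packed word is `u`. -/
noncomputable def M {n : ℕ} (u : PackedWord n) : WQSym K n :=
  ⟨fun w => if pack w = u.1 then 1 else 0, by
    intro w w' h
    simp [h]⟩

open Classical in
/-- The element `Φ_u`: the sum of the `M_v` over the packed words `v` finer than `u` that have
the same standardization as `u`. -/
noncomputable def Phi {n : ℕ} (u : PackedWord n) : WQSym K n :=
  ∑ v ∈ univ.filter (fun v : PackedWord n => Coarser u.1 v.1 ∧ std v.1 = std u.1), M K v

open Classical in
/-- The linear map `ω` with `ω M_u = (-1)^{n - max u} ∑_{v ≤ u} M_v`. Here the coefficient of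
`M_u` in an element `f` is the coefficient of the word `u` itself. -/
noncomputable def omega (n : ℕ) : WQSym K n →ₗ[K] WQSym K n where
  toFun f := ∑ u : PackedWord n, (f.1 u.1 * (-1) ^ (n - maxLetter u.1)) •
    ∑ v ∈ univ.filter (fun v : PackedWord n => Coarser v.1 u.1), M K v
  map_add' f g := by
    simp [add_mul, add_smul, Finset.sum_add_distrib]
  map_smul' c f := by
    simp [mul_assoc, mul_smul, Finset.smul_sum]

variable {K}

open Classical in
/-- The number `asc_G(w)` of edges `i < j` of `G` such that `w_i < w_j`. -/
noncomputable def asc {n : ℕ} (G : SimpleGraph (Fin n)) (w : Fin n → ℕ) : ℕ :=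
  (univ.filter (fun p : Fin n × Fin n => p.1 < p.2 ∧ G.Adj p.1 p.2 ∧ w p.1 < w p.2)).card

/-- The noncommutative unicellular LLT polynomial
`LLT_G(A; q) = ∑_u q^{asc_G(u)} M_u`, the sum over all packed words. -/
noncomputable def LLT {n : ℕ} (G : SimpleGraph (Fin n)) (q : K) : WQSym K n :=
  ∑ u : PackedWord n, q ^ asc G u.1 • M K u

/-- The modified polynomial `q^{e(G)} LLT_G(A; q⁻¹)`, where `e(G)` is the number of edges. -/
noncomputable def LLTtilde {n : ℕ} (G : SimpleGraph (Fin n)) (q : K) : WQSym K n :=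
  q ^ G.edgeSet.ncard • LLT G q⁻¹

end WQSym

/-! ### Diagrams, arms, legs and the two graphs of a partition

A partition is given by its diagram `μ`. The cell `(i, j)` lies in row `i` and column `j`, both
counted from `0`; row `0` has length `μ₁` and is drawn at the bottom (French notation). -/

/-- The number of cells to the right of a cell, in the same row. -/
def arm (μ : YoungDiagram) (c : ℕ × ℕ) : ℕ := μ.rowLen c.1 - (c.2 + 1)

/-- The number of cells above a cell, in the same column. -/
def leg (μ : YoungDiagram) (c : ℕ × ℕ) : ℕ := μ.colLen c.2 - (c.1 + 1)

/-- The statistic `n(μ) = ∑ i (i - 1) μ_i`. -/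
def nStat (μ : YoungDiagram) : ℕ := ∑ c ∈ μ.cells, c.1

/-- The linear order by rows from top to bottom, and from left to right in each row. -/
def readingEmb : ℕ × ℕ ↪ ℕᵒᵈ ×ₗ ℕ where
  toFun c := toLex (OrderDual.toDual c.1, c.2)
  inj' := by
    rintro ⟨a, b⟩ ⟨c, d⟩ h
    simpa using h

/-- The cells of `μ` in reading order: `cellAt μ a` is the cell that carries the label `a`. -/
def cellAt (μ : YoungDiagram) (a : Fin μ.card) : ℕ × ℕ :=
  let x := ofLex ((μ.cells.map readingEmb).orderEmbOfFin (card_map _) a)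
  (OrderDual.ofDual x.1, x.2)

/-- Cells `c` and `d` with `c` before `d` in reading order attack each other if they lie in the
same row, or `d` lies in the row just below `c`, strictly to the left of `c`. -/
def Attacks (c d : ℕ × ℕ) : Prop :=
  (c.1 = d.1 ∧ c.2 < d.2) ∨ (c.1 = d.1 + 1 ∧ d.2 < c.2)

/-- `IsSouth μ a b`: the cell with label `b` is the cell just below the cell with label `a`. -/
def IsSouth (μ : YoungDiagram) (a b : Fin μ.card) : Prop :=
  (cellAt μ a).1 = (cellAt μ b).1 + 1 ∧ (cellAt μ a).2 = (cellAt μ b).2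

/-- The graph `G_μ`: the vertices are the cells, labelled in reading order, and the edges join the
attacking pairs of cells. -/
def graph (μ : YoungDiagram) : SimpleGraph (Fin μ.card) :=
  SimpleGraph.fromRel (fun a b => Attacks (cellAt μ a) (cellAt μ b))

/-- The graph `G_μ⁺`: the graph `G_μ` with the additional edges that join each cell outside the
bottom row to the cell just below it. -/
def graphPlus (μ : YoungDiagram) : SimpleGraph (Fin μ.card) :=
  graph μ ⊔ SimpleGraph.fromRel (IsSouth μ)

open Classical in
/-- The labels of the cells `u` such that the vertical edge from `u` to the cell just below `u`
is an edge of `H`. -/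
noncomputable def upperCells (μ : YoungDiagram) (H : SimpleGraph (Fin μ.card)) :
    Finset (Fin μ.card) :=
  univ.filter (fun a => ∃ b, IsSouth μ a b ∧ H.Adj a b)

open Classical in
/-- The multi-`t` noncommutative Macdonald function `H_μ(A; q, t_1, …, t_{r-1})`, where
`t i` stands for `t_i`; only `t_1, …, t_{r-1}` occur. The sum runs over the graphs `H` with
`G_μ ⊆ H ⊆ G_μ⁺`; the edges of `H ∖ G_μ` and `G_μ⁺ ∖ H` are identified with their upper cells. -/
noncomputable def Hmu {K : Type*} [Field K] (μ : YoungDiagram) (q : K) (t : ℕ → K) :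
    WQSym K μ.card :=
  (q ^ (-(nStat μ.transpose : ℤ) + ((μ.rowLen 0).choose 2 : ℤ)) /
      (q - 1) ^ (μ.card - μ.rowLen 0)) •
    ∑ H ∈ univ.filter (fun H : SimpleGraph (Fin μ.card) => graph μ ≤ H ∧ H ≤ graphPlus μ),
      ((∏ a ∈ upperCells μ (H \ graph μ),
          (1 - t (1 + leg μ (cellAt μ a)) * q ^ arm μ (cellAt μ a))) *
        ∏ a ∈ upperCells μ (graphPlus μ \ H),
          (t (1 + leg μ (cellAt μ a)) * q ^ (arm μ (cellAt μ a) + 1) - 1)) •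
      omega K μ.card (LLTtilde H q)

/-! ### Statistics of a standard filling

The filling of `μ` by `σ` puts `σ a` into the cell with label `a`. -/

open Classical in
/-- `Inv(σ, μ)`: the number of attacking pairs of cells, the first one in reading order having the
larger entry. -/
noncomputable def Inv (μ : YoungDiagram) (σ : Equiv.Perm (Fin μ.card)) : ℕ :=
  (univ.filter (fun p : Fin μ.card × Fin μ.card =>
    p.1 < p.2 ∧ (graph μ).Adj p.1 p.2 ∧ σ p.2 < σ p.1)).card

open Classical in
/-- `Des(σ, μ)`: the cells whose entry is larger than the entry just below. -/
noncomputable def Des (μ : YoungDiagram) (σ : Equiv.Perm (Fin μ.card)) : Finset (Fin μ.card) :=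
  univ.filter (fun a => ∃ b, IsSouth μ a b ∧ σ b < σ a)

open Classical in
/-- `Asc(σ, μ)`: the cells whose entry is smaller than the entry just below. -/
noncomputable def Asc (μ : YoungDiagram) (σ : Equiv.Perm (Fin μ.card)) : Finset (Fin μ.card) :=
  univ.filter (fun a => ∃ b, IsSouth μ a b ∧ σ a < σ b)

/-- The number of cells `u` of `Asc(σ, μ)` with `1 + leg(u) = i`. -/
noncomputable def ascLeg (μ : YoungDiagram) (σ : Equiv.Perm (Fin μ.card)) (i : ℕ) : ℕ :=
  ((Asc μ σ).filter (fun a => 1 + leg μ (cellAt μ a) = i)).card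

end NCMacdonald

namespace NCMacdonald

open Finset

/-! ### Packed words -/

section Words

variable {n : ℕ}

/-! An element of `WQSym` is determined by its coefficients at packed words `v`, and both sides turn
out to depend only on the standardization of `v`.

The coefficient of `LLTtilde H q` at `u` is `q` to the number of weak inversions `u_j ≤ u_i` along
edges `i < j` of `H`, so `ω` produces at `v` the signed sum of these powers over all refinements `u`
of `v`. A sign-reversing involution cancels every refinement in which some block of `v` is not
strictly increasing from left to right (`toggle_spec`, `sum_refinements`). Only `std v` survives;
its weak inversions are the strict inversions of `v`, leaving the single power `q ^ strictInv H v`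
(`omega_LLTtilde_apply`).

The graphs between `G_μ` and `G_μ⁺` correspond to the sets of cells outside the bottom row, and each
added vertical edge contributes a factor `q` exactly when `v` has a descent there. The sum over `H`
is therefore a product over these cells (`sum_interval`). With `T = t q^arm`, the local factor is
`(1 - T) q + (T q - 1) = q - 1` at a descent and `(1 - T) + (T q - 1) = (q - 1) T` otherwise. The
denominator removes the powers of `q - 1`. The prefactor is `q` to minus the sum of the arms outside
the bottom row (`sum_arm_upper`), which turns `T` into `t` at ascents and leaves `q^(-arm)` at
descents (`Hmu_apply`). As `Φ_{min(σ)}` is the indicator of the packed words with standardization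
`σ` (`Phi_minDestd_apply`), the expansion follows.

The basis property is triangularity for refinement. The exponent of `q` is nonnegative because a
descent `u` and a cell `w` to its right always yield an inversion: `(u, w)` or `(w, South(u))`
(`sum_arm_Des_le_Inv`). -/

theorem le_maxLetter (u : Fin n → ℕ) (i : Fin n) : u i ≤ maxLetter u :=
  Finset.le_sup (f := u) (mem_univ i)

/-- A form free of the maximal letter, which splitting and merging blocks change. -/
theorem isPacked_iff {u : Fin n → ℕ} :
    IsPacked u ↔ (∀ i, 1 ≤ u i) ∧ ∀ i y, 1 ≤ y → y ≤ u i → ∃ j, u j = y := by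
  constructor
  · intro h
    have h' : ∀ y, (∃ j, u j = y) ↔ 1 ≤ y ∧ y ≤ maxLetter u := by
      intro y
      have := congrArg (fun s => y ∈ s) h
      simpa using this
    refine ⟨fun i => ((h' _).1 ⟨i, rfl⟩).1, fun i y h1 h2 => (h' _).2 ⟨h1, ?_⟩⟩
    exact h2.trans (le_maxLetter u i)
  · rintro ⟨h1, h2⟩
    ext y
    simp only [mem_image, mem_univ, true_and, mem_Icc]
    constructor
    · rintro ⟨i, rfl⟩
      exact ⟨h1 i, le_maxLetter u i⟩
    · rintro ⟨h3, h4⟩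
      obtain ⟨i, -, hi⟩ := (Finset.le_sup_iff (show (⊥ : ℕ) < y from h3)).1 h4
      exact h2 i y h3 hi

theorem IsPacked.pack_eq {u : Fin n → ℕ} (hu : IsPacked u) : pack u = u := by
  funext i
  have h : (univ.image u).filter (fun x => x ≤ u i) = Icc 1 (u i) := by
    rw [hu]
    ext x
    have := le_maxLetter u i
    simp only [mem_filter, mem_Icc]
    omega
  simp [pack, h]

theorem isPacked_pack (w : Fin n → ℕ) : IsPacked (pack w) := by
  rw [isPacked_iff]
  refine ⟨fun i => card_pos.2 ⟨w i, by simp⟩, ?_⟩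
  -- Ranks in a finite set fill an initial interval; adjoining a new maximum adds one rank and keeps
  -- the others.
  have key : ∀ (s : Finset ℕ) (y : ℕ), 1 ≤ y → y ≤ s.card →
      ∃ x ∈ s, (s.filter (fun z => z ≤ x)).card = y := by
    intro s
    induction s using Finset.induction_on_max with
    | empty => intro y h1 h2; simp at h2; omega
    | insert a s ha ih =>
      intro y h1 h2
      have hna : a ∉ s := fun h => lt_irrefl _ (ha a h)
      rw [card_insert_of_notMem hna] at h2
      by_cases h : y ≤ s.card
      · obtain ⟨x, hx, e⟩ := ih y h1 h
        refine ⟨x, mem_insert_of_mem hx, ?_⟩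
        rw [filter_insert, if_neg (not_le.2 (ha x hx)), e]
      · refine ⟨a, mem_insert_self _ _, ?_⟩
        rw [filter_true_of_mem, card_insert_of_notMem hna]
        · omega
        · intro z hz
          rcases mem_insert.1 hz with rfl | hz
          · exact le_rfl
          · exact (ha z hz).le
  intro i y h1 h2
  obtain ⟨x, hx, e⟩ := key (univ.image w) y h1 (h2.trans (card_filter_le _ _))
  obtain ⟨j, -, rfl⟩ := mem_image.1 hx
  exact ⟨j, e⟩

/-- Induction on the letter of `v`: the preceding letter occurs at some `j`, and `v j < v i` forces
`u j < u i`. -/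
theorem Coarser.le {v u : Fin n → ℕ} (h : Coarser v u) (hv : IsPacked v) (hu : IsPacked u)
    (i : Fin n) : v i ≤ u i := by
  obtain ⟨k, hk⟩ : ∃ k, v i = k := ⟨_, rfl⟩
  induction k generalizing i with
  | zero => omega
  | succ k ih =>
    rcases Nat.eq_zero_or_pos k with rfl | hk0
    · have := (isPacked_iff.1 hu).1 i
      omega
    · obtain ⟨j, hj⟩ := (isPacked_iff.1 hv).2 i k hk0 (by omega)
      have h1 := ih j hj
      have h2 : u j < u i := by
        by_contra hcon
        have := h i j (by omega)
        omega
      omega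

theorem Coarser.antisymm {v u : Fin n → ℕ} (h : Coarser v u) (h' : Coarser u v)
    (hv : IsPacked v) (hu : IsPacked u) : v = u :=
  funext fun i => le_antisymm (h.le hv hu i) (h'.le hu hv i)

/-! ### A sign-reversing involution on the refinements of a word -/

/-- Position `m` is not in standard order with respect to an earlier position of its block. -/
def Misplaced (v u : Fin n → ℕ) (m : Fin n) : Prop := ∃ i < m, v i = v m ∧ u m ≤ u i

/-- The last misplaced position. -/
def LastMisplaced (v u : Fin n → ℕ) (m : Fin n) : Prop :=
  Misplaced v u m ∧ ∀ j, m < j → ¬ Misplaced v u j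

theorem LastMisplaced.unique {v u : Fin n → ℕ} {m m' : Fin n} (h : LastMisplaced v u m)
    (h' : LastMisplaced v u m') : m = m' :=
  le_antisymm (not_lt.1 fun hlt => h'.2 _ hlt h.1) (not_lt.1 fun hlt => h.2 _ hlt h'.1)

theorem exists_lastMisplaced {v u : Fin n → ℕ} (h : ∃ m, Misplaced v u m) :
    ∃ m, LastMisplaced v u m := by
  classical
  obtain ⟨m, hm⟩ := h
  have hne : (univ.filter (Misplaced v u)).Nonempty := ⟨m, by simpa using hm⟩
  refine ⟨_, (mem_filter.1 (max'_mem _ hne)).2, fun j hj hb => ?_⟩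
  exact absurd (le_max' _ j (by simpa using hb)) (not_le.2 hj)

/-- Split position `m` off its block, as a new block just before it. -/
def splitOff (u : Fin n → ℕ) (m : Fin n) : Fin n → ℕ :=
  fun i => if i ≠ m ∧ u m ≤ u i then u i + 1 else u i

/-- Merge the block of position `m` with the next block. -/
def mergeNext (u : Fin n → ℕ) (m : Fin n) : Fin n → ℕ :=
  fun i => if u m < u i then u i - 1 else u i

/-! ### Splitting a position off its block -/

section Split

variable {v u : Fin n → ℕ} {m : Fin n}

theorem splitOff_self : splitOff u m m = u m := by simp [splitOff]

theorem splitOff_of_ne {i : Fin n} (h : i ≠ m) :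
    (u m ≤ u i ∧ splitOff u m i = u i + 1) ∨ (u i < u m ∧ splitOff u m i = u i) := by
  by_cases h' : u m ≤ u i
  · left; simp [splitOff, h, h']
  · right; simp [splitOff, h']; omega

theorem le_of_splitOff_le {i j : Fin n} (h : splitOff u m i ≤ splitOff u m j) : u i ≤ u j := by
  by_cases hi : i = m
  · subst hi
    by_cases hj : j = i
    · subst hj; exact le_rfl
    · rw [splitOff_self] at h
      rcases splitOff_of_ne (u := u) hj with h1 | h1 <;> omega
  · by_cases hj : j = m
    · subst hj
      rw [splitOff_self] at h
      rcases splitOff_of_ne (u := u) hi with h1 | h1 <;> omega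
    · rcases splitOff_of_ne (u := u) hi with h1 | h1 <;>
        rcases splitOff_of_ne (u := u) hj with h2 | h2 <;> omega

/-- A later position of the same block of `u` would itself be misplaced, with `m` as witness. -/
theorem LastMisplaced.lt_of_eq (hc : Coarser v u) (hm : LastMisplaced v u m) {j : Fin n}
    (hj : j ≠ m) (h : u j = u m) : j < m := by
  by_contra hlt
  have hlt : m < j := lt_of_le_of_ne (not_lt.1 hlt) (Ne.symm hj)
  exact hm.2 j hlt ⟨m, hlt, le_antisymm (hc _ _ h.ge) (hc _ _ h.le), h.le⟩

theorem IsPacked.splitOff (hu : IsPacked u) (h : ∃ j, j ≠ m ∧ u j = u m) :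
    IsPacked (splitOff u m) := by
  obtain ⟨j0, hj0, e0⟩ := h
  rw [isPacked_iff] at hu ⊢
  refine ⟨fun i => ?_, fun i y h1 h2 => ?_⟩
  · have := hu.1 i
    unfold NCMacdonald.splitOff
    split_ifs <;> omega
  · rcases lt_trichotomy y (u m) with hy | hy | hy
    · obtain ⟨j, hj⟩ := hu.2 m y h1 hy.le
      refine ⟨j, ?_⟩
      have : j ≠ m := by rintro rfl; omega
      rcases splitOff_of_ne (u := u) this with h3 | h3 <;> omega
    · exact ⟨m, by rw [splitOff_self, hy]⟩
    · by_cases hy' : y = u m + 1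
      · refine ⟨j0, ?_⟩
        rcases splitOff_of_ne (u := u) hj0 with h3 | h3 <;> omega
      · have h4 : y ≤ u i + 1 := by
          unfold NCMacdonald.splitOff at h2
          split_ifs at h2 <;> omega
        obtain ⟨j, hj⟩ := hu.2 i (y - 1) (by omega) (by omega)
        refine ⟨j, ?_⟩
        have : j ≠ m := by rintro rfl; omega
        rcases splitOff_of_ne (u := u) this with h3 | h3 <;> omega

theorem maxLetter_splitOff (h : ∃ j, j ≠ m ∧ u j = u m) :
    maxLetter (splitOff u m) = maxLetter u + 1 := by
  obtain ⟨j0, hj0, e0⟩ := h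
  apply le_antisymm
  · refine Finset.sup_le fun i _ => ?_
    have := le_maxLetter u i
    unfold splitOff
    split_ifs <;> omega
  · obtain ⟨i, -, hi⟩ := exists_mem_eq_sup (univ : Finset (Fin n)) ⟨m, mem_univ _⟩ u
    have hi : maxLetter u = u i := hi
    have hle := le_maxLetter u m
    by_cases him : i = m
    · have := le_maxLetter (splitOff u m) j0
      subst him
      rcases splitOff_of_ne (u := u) hj0 with h3 | h3 <;> omega
    · have := le_maxLetter (splitOff u m) i
      rcases splitOff_of_ne (u := u) him with h3 | h3 <;> omega

theorem Coarser.splitOff (hc : Coarser v u) : Coarser v (splitOff u m) :=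
  fun i j h => hc i j (le_of_splitOff_le h)

theorem LastMisplaced.splitOff (hm : LastMisplaced v u m) :
    LastMisplaced v (splitOff u m) m := by
  refine ⟨?_, ?_⟩
  · obtain ⟨i, hi, h1, h2⟩ := hm.1
    refine ⟨i, hi, h1, ?_⟩
    rw [splitOff_self]
    rcases splitOff_of_ne (u := u) hi.ne with h3 | h3 <;> omega
  · rintro j hj ⟨i, hi, h1, h2⟩
    exact hm.2 j hj ⟨i, hi, h1, le_of_splitOff_le h2⟩

/-- Only comparisons of `m` with the rest of its block can change. Those positions stand to the left
of `m`, and their letters merely go from equal to larger, so weak inversions persist. -/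
theorem LastMisplaced.splitOff_le_iff (hc : Coarser v u) (hm : LastMisplaced v u m)
    {i j : Fin n} (hij : i < j) : NCMacdonald.splitOff u m j ≤ NCMacdonald.splitOff u m i ↔ u j ≤ u i := by
  refine ⟨le_of_splitOff_le, fun h => ?_⟩
  by_cases hi : i = m
  · subst hi
    rw [splitOff_self]
    rcases splitOff_of_ne (u := u) hij.ne' with h3 | h3
    · exact absurd hij (not_lt.2 (hm.lt_of_eq hc hij.ne' (by omega)).le)
    · omega
  · by_cases hj : j = m
    · subst hj
      rw [splitOff_self]
      rcases splitOff_of_ne (u := u) hi with h3 | h3 <;> omega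
    · rcases splitOff_of_ne (u := u) hi with h1 | h1 <;>
        rcases splitOff_of_ne (u := u) hj with h2 | h2 <;> omega

theorem not_exists_splitOff_eq : ¬ ∃ j, j ≠ m ∧ splitOff u m j = splitOff u m m := by
  rintro ⟨j, hj, h⟩
  rw [splitOff_self] at h
  rcases splitOff_of_ne (u := u) hj with h3 | h3 <;> omega

theorem mergeNext_splitOff : mergeNext (splitOff u m) m = u := by
  funext i
  unfold mergeNext
  by_cases hi : i = m
  · subst hi; simp [splitOff_self]
  · rw [splitOff_self]
    rcases splitOff_of_ne (u := u) hi with h3 | h3 <;> split_ifs <;> omega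

end Split

/-! ### Merging a singleton block with the next one -/

section Merge

variable {v u : Fin n → ℕ} {m : Fin n}

theorem mergeNext_self : mergeNext u m m = u m := by simp [mergeNext]

theorem mergeNext_cases (i : Fin n) :
    (u m < u i ∧ mergeNext u m i + 1 = u i) ∨ (u i ≤ u m ∧ mergeNext u m i = u i) := by
  unfold mergeNext
  split_ifs with h
  · left; omega
  · right; omega

theorem splitOff_mergeNext (h : ¬ ∃ j, j ≠ m ∧ u j = u m) : splitOff (mergeNext u m) m = u := by
  funext i
  by_cases hi : i = m
  · subst hi; rw [splitOff_self, mergeNext_self]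
  · have hne : u i ≠ u m := fun e => h ⟨i, hi, e⟩
    rcases splitOff_of_ne (u := mergeNext u m) hi with h3 | h3 <;>
      rw [mergeNext_self] at h3 <;>
      rcases mergeNext_cases (u := u) (m := m) i with h4 | h4 <;> omega

theorem IsPacked.mergeNext (hu : IsPacked u) : IsPacked (mergeNext u m) := by
  rw [isPacked_iff] at hu ⊢
  refine ⟨fun i => ?_, fun i y h1 h2 => ?_⟩
  · have := hu.1 m
    have := hu.1 i
    rcases mergeNext_cases (u := u) (m := m) i with h4 | h4 <;> omega
  · by_cases hy : y ≤ u m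
    · obtain ⟨j, hj⟩ := hu.2 m y h1 hy
      refine ⟨j, ?_⟩
      rcases mergeNext_cases (u := u) (m := m) j with h4 | h4 <;> omega
    · obtain ⟨j, hj⟩ := hu.2 i (y + 1) (by omega) (by
        rcases mergeNext_cases (u := u) (m := m) i with h4 | h4 <;> omega)
      refine ⟨j, ?_⟩
      rcases mergeNext_cases (u := u) (m := m) j with h4 | h4 <;> omega

theorem LastMisplaced.exists_gt (hm : LastMisplaced v u m) (h : ¬ ∃ j, j ≠ m ∧ u j = u m) :
    ∃ i < m, v i = v m ∧ u m < u i := by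
  obtain ⟨i, hi, h1, h2⟩ := hm.1
  exact ⟨i, hi, h1, lt_of_le_of_ne h2 fun e => h ⟨i, hi.ne, e.symm⟩⟩

/-- The witness of the misplacement has a letter of at least `u m + 1`, so the next block is
squeezed into the block of `v` containing `m`. A position of it to the right of `m` would be
misplaced by the same witness. -/
theorem LastMisplaced.next_block (hc : Coarser v u) (hm : LastMisplaced v u m)
    (h : ¬ ∃ j, j ≠ m ∧ u j = u m) {j : Fin n} (hj : u j = u m + 1) : j < m ∧ v j = v m := by
  obtain ⟨i, hi, h1, h2⟩ := hm.exists_gt h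
  have hv : v j = v m :=
    le_antisymm (h1 ▸ hc j i (by omega)) (hc m j (by omega))
  refine ⟨?_, hv⟩
  by_contra hlt
  have hne : m ≠ j := by rintro rfl; omega
  have hlt : m < j := lt_of_le_of_ne (not_lt.1 hlt) hne
  exact hm.2 j hlt ⟨i, hi.trans hlt, by omega, by omega⟩

theorem le_of_mergeNext_le (h : ¬ ∃ j, j ≠ m ∧ u j = u m) {i j : Fin n}
    (hij : mergeNext u m i ≤ mergeNext u m j) : u i ≤ u j ∨ (j = m ∧ u i = u m + 1) := by
  by_cases hj : j = m
  · subst hj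
    rw [mergeNext_self] at hij
    rcases mergeNext_cases (u := u) (m := j) i with h4 | h4 <;> omega
  · have hne : u j ≠ u m := fun e => h ⟨j, hj, e⟩
    rcases mergeNext_cases (u := u) (m := m) i with h4 | h4 <;>
      rcases mergeNext_cases (u := u) (m := m) j with h5 | h5 <;> omega

theorem LastMisplaced.coarser_mergeNext (hc : Coarser v u) (hm : LastMisplaced v u m)
    (h : ¬ ∃ j, j ≠ m ∧ u j = u m) : Coarser v (NCMacdonald.mergeNext u m) := by
  intro i j hij
  rcases le_of_mergeNext_le h hij with h1 | ⟨rfl, h1⟩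
  · exact hc i j h1
  · exact (hm.next_block hc h h1).2.le

theorem LastMisplaced.mergeNext (hc : Coarser v u) (hm : LastMisplaced v u m)
    (h : ¬ ∃ j, j ≠ m ∧ u j = u m) : LastMisplaced v (mergeNext u m) m := by
  refine ⟨?_, ?_⟩
  · obtain ⟨i, hi, h1, h2⟩ := hm.exists_gt h
    refine ⟨i, hi, h1, ?_⟩
    rw [mergeNext_self]
    rcases mergeNext_cases (u := u) (m := m) i with h4 | h4 <;> omega
  · rintro j hj ⟨i, hi, h1, h2⟩
    rcases le_of_mergeNext_le h h2 with h3 | ⟨rfl, h3⟩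
    · exact hm.2 j hj ⟨i, hi, h1, h3⟩
    · exact absurd hj (not_lt.2 (hm.next_block hc h h3).1.le)

theorem LastMisplaced.exists_mergeNext_eq (hu : IsPacked u)
    (hm : LastMisplaced v u m) (h : ¬ ∃ j, j ≠ m ∧ u j = u m) :
    ∃ j, j ≠ m ∧ NCMacdonald.mergeNext u m j = NCMacdonald.mergeNext u m m := by
  obtain ⟨i, hi, h1, h2⟩ := hm.exists_gt h
  obtain ⟨j, hj⟩ := (isPacked_iff.1 hu).2 i (u m + 1) (by omega) h2
  refine ⟨j, by rintro rfl; omega, ?_⟩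
  rw [mergeNext_self]
  rcases mergeNext_cases (u := u) (m := m) j with h4 | h4 <;> omega

end Merge

/-! ### The involution and the statistics it preserves -/

open Classical in
/-- Split position `m` off its block if it is not alone in it, otherwise merge its block with the
next one. -/
noncomputable def toggle (u : Fin n → ℕ) (m : Fin n) : Fin n → ℕ :=
  if ∃ j, j ≠ m ∧ u j = u m then splitOff u m else mergeNext u m

open Classical in
/-- The number of edges `i < j` of `H` such that `u_j ≤ u_i`. -/
noncomputable def weakInv (H : SimpleGraph (Fin n)) (u : Fin n → ℕ) : ℕ :=
  (univ.filter (fun p : Fin n × Fin n => p.1 < p.2 ∧ H.Adj p.1 p.2 ∧ u p.2 ≤ u p.1)).card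

open Classical in
/-- The number of edges `i < j` of `H` such that `u_j < u_i`. -/
noncomputable def strictInv (H : SimpleGraph (Fin n)) (u : Fin n → ℕ) : ℕ :=
  (univ.filter (fun p : Fin n × Fin n => p.1 < p.2 ∧ H.Adj p.1 p.2 ∧ u p.2 < u p.1)).card

open Classical in
theorem weakInv_congr (H : SimpleGraph (Fin n)) {u u' : Fin n → ℕ}
    (h : ∀ i j, i < j → (u j ≤ u i ↔ u' j ≤ u' i)) : weakInv H u = weakInv H u' := by
  unfold weakInv
  congr 1
  refine filter_congr fun p _ => ?_
  constructor <;> rintro ⟨h1, h2, h3⟩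
  · exact ⟨h1, h2, (h _ _ h1).1 h3⟩
  · exact ⟨h1, h2, (h _ _ h1).2 h3⟩

theorem IsPacked.maxLetter_le {u : Fin n → ℕ} (hu : IsPacked u) : maxLetter u ≤ n :=
  Finset.sup_le fun i _ => hu.le i

theorem neg_one_pow_splitOff (K : Type*) [Ring K] {u : Fin n → ℕ} {m : Fin n} (hu : IsPacked u)
    (h : ∃ j, j ≠ m ∧ u j = u m) :
    (-1 : K) ^ (n - maxLetter u) + (-1) ^ (n - maxLetter (splitOff u m)) = 0 := by
  have h1 := (hu.splitOff h).maxLetter_le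
  rw [maxLetter_splitOff h] at h1 ⊢
  rw [show n - maxLetter u = (n - (maxLetter u + 1)) + 1 by omega, pow_succ]
  simp

theorem toggle_spec (K : Type*) [Ring K] {v u : Fin n → ℕ} {m : Fin n} (hu : IsPacked u)
    (hc : Coarser v u) (hm : LastMisplaced v u m) :
    IsPacked (toggle u m) ∧ Coarser v (toggle u m) ∧ LastMisplaced v (toggle u m) m ∧
    toggle (toggle u m) m = u ∧
    (-1 : K) ^ (n - maxLetter u) + (-1) ^ (n - maxLetter (toggle u m)) = 0 ∧
    (∀ H, weakInv H (toggle u m) = weakInv H u) ∧ toggle u m ≠ u := by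
  by_cases h : ∃ j, j ≠ m ∧ u j = u m
  · have e : toggle u m = splitOff u m := if_pos h
    rw [e]
    refine ⟨hu.splitOff h, hc.splitOff, hm.splitOff, ?_, neg_one_pow_splitOff K hu h, ?_, ?_⟩
    · rw [toggle, if_neg not_exists_splitOff_eq, mergeNext_splitOff]
    · exact fun H => weakInv_congr H fun i j hij => hm.splitOff_le_iff hc hij
    · intro e'
      have := not_exists_splitOff_eq (u := u) (m := m)
      rw [e'] at this
      exact this h
  · have e : toggle u m = mergeNext u m := if_neg h
    have h' := hm.exists_mergeNext_eq hu h
    have hm' := hm.mergeNext hc h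
    have hc' := hm.coarser_mergeNext hc h
    -- Merging is inverse to splitting, so the sign and the weak inversions are read off from the
    -- split case applied to the merged word.
    have es := splitOff_mergeNext h
    rw [e]
    refine ⟨hu.mergeNext, hc', hm', ?_, ?_, ?_, ?_⟩
    · rw [toggle, if_pos h', es]
    · have := neg_one_pow_splitOff K hu.mergeNext h'
      rw [es] at this
      rw [add_comm, this]
    · intro H
      refine weakInv_congr H fun i j hij => ?_
      have := hm'.splitOff_le_iff hc' hij
      rw [es] at this
      exact this.symm
    · intro e'
      rw [e'] at h'
      exact h h'

/-! ### Standardization -/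

theorem std_lt_iff (w : Fin n → ℕ) (i j : Fin n) :
    std w i < std w j ↔ w i < w j ∨ (w i = w j ∧ i < j) := by
  have key : ∀ i j : Fin n, (w i < w j ∨ (w i = w j ∧ i < j)) → std w i < std w j := by
    intro i j h
    refine card_lt_card ?_
    rw [Finset.ssubset_iff_of_subset]
    · refine ⟨j, by simp, ?_⟩
      simp only [mem_filter, mem_univ, true_and, not_or, not_and, not_le]
      rcases h with h | h
      · exact ⟨by omega, fun e => by omega⟩
      · exact ⟨by omega, fun e => h.2⟩
    · intro a
      simp only [mem_filter, mem_univ, true_and]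
      rintro (h1 | h1) <;> rcases h with h | h
      · left; omega
      · left; omega
      · left; omega
      · right; exact ⟨h1.1.trans h.1, h1.2.trans h.2.le⟩
  refine ⟨fun h => ?_, key i j⟩
  by_contra hcon
  by_cases hij : i = j
  · subst hij; exact lt_irrefl _ h
  · have := key j i (by
      rcases lt_trichotomy (w i) (w j) with h1 | h1 | h1
      · exact absurd (Or.inl h1) hcon
      · right
        refine ⟨h1.symm, lt_of_le_of_ne (not_lt.1 fun h2 => hcon (Or.inr ⟨h1, h2⟩)) (Ne.symm hij)⟩
      · exact Or.inl h1)
    omega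

theorem std_injective (w : Fin n → ℕ) : Function.Injective (std w) := by
  intro i j h
  by_contra hij
  have h1 := std_lt_iff w i j
  have h2 := std_lt_iff w j i
  rcases lt_or_gt_of_ne hij with h3 | h3 <;> rcases lt_trichotomy (w i) (w j) with h4 | h4 | h4 <;>
    simp [h, h3, h4] at h1 h2

theorem std_pos (w : Fin n → ℕ) (i : Fin n) : 1 ≤ std w i := card_pos.2 ⟨i, by simp⟩

theorem std_le (w : Fin n → ℕ) (i : Fin n) : std w i ≤ n := by
  simpa [std] using card_filter_le (univ : Finset (Fin n))
    (fun j => w j < w i ∨ (w j = w i ∧ j ≤ i))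

/-- A permutation `σ` standardizes `w` if it is the standardization of `w`, up to a shift by `1`
of the letters. -/
def Standardizes (σ : Equiv.Perm (Fin n)) (w : Fin n → ℕ) : Prop :=
  ∀ i, std w i = (σ i : ℕ) + 1

theorem exists_standardizes (w : Fin n → ℕ) : ∃ σ : Equiv.Perm (Fin n), Standardizes σ w := by
  let f : Fin n → Fin n := fun i => ⟨std w i - 1, by
    have := std_pos w i
    have := std_le w i
    omega⟩
  have hf : Function.Injective f := by
    intro i j h
    apply std_injective w
    have h' : std w i - 1 = std w j - 1 := by simpa [f] using h
    have := std_pos w i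
    have := std_pos w j
    omega
  refine ⟨Equiv.ofBijective f (Finite.injective_iff_bijective.1 hf), fun i => ?_⟩
  have := std_pos w i
  simp only [Equiv.ofBijective_apply, f]
  omega

theorem Standardizes.lt_iff {σ : Equiv.Perm (Fin n)} {w : Fin n → ℕ} (h : Standardizes σ w)
    (i j : Fin n) : σ i < σ j ↔ w i < w j ∨ (w i = w j ∧ i < j) := by
  rw [← std_lt_iff, h i, h j, Fin.lt_def]
  omega

theorem isPacked_std (w : Fin n → ℕ) : IsPacked (std w) := by
  obtain ⟨σ, h⟩ := exists_standardizes w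
  rw [isPacked_iff]
  refine ⟨std_pos w, fun i y h1 h2 => ?_⟩
  have := std_le w i
  refine ⟨σ.symm ⟨y - 1, by omega⟩, ?_⟩
  rw [h, Equiv.apply_symm_apply]
  simp only
  omega

theorem coarser_std (w : Fin n → ℕ) : Coarser w (std w) := by
  intro i j h
  by_contra hcon
  have := (std_lt_iff w j i).2 (Or.inl (not_le.1 hcon))
  omega

/-- Without misplaced positions, `u` increases strictly from left to right on each block of `v`, so
it orders the positions as `std v` does; packed words inducing the same order are equal. -/
theorem Coarser.eq_of_not_misplaced {v u : Fin n → ℕ} (hu : IsPacked u) (hc : Coarser v u)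
    (h : ∀ m, ¬ Misplaced v u m) : u = std v := by
  have key : ∀ i j, u i < u j ↔ std v i < std v j := by
    intro i j
    rw [std_lt_iff]
    constructor
    · intro hlt
      rcases (hc i j hlt.le).lt_or_eq with h1 | h1
      · exact Or.inl h1
      · refine Or.inr ⟨h1, ?_⟩
        by_contra hij
        have hne : i ≠ j := by rintro rfl; omega
        exact h i ⟨j, lt_of_le_of_ne (not_lt.1 hij) hne.symm, h1.symm, hlt.le⟩
    · rintro (h1 | ⟨h1, h2⟩)
      · by_contra hcon
        have := hc j i (not_lt.1 hcon)
        omega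
      · by_contra hcon
        exact h j ⟨i, h2, h1, not_lt.1 hcon⟩
  refine Coarser.antisymm (fun i j => ?_) (fun i j => ?_) hu (isPacked_std v)
  · rw [← not_lt, ← not_lt, key]; exact id
  · rw [← not_lt, ← not_lt, key]; exact id

theorem not_misplaced_std (v : Fin n → ℕ) (m : Fin n) : ¬ Misplaced v (std v) m := by
  rintro ⟨i, hi, h1, h2⟩
  have := (std_lt_iff v i m).2 (Or.inr ⟨h1, hi⟩)
  omega

theorem maxLetter_std (w : Fin n → ℕ) : maxLetter (std w) = n := by
  have h := congrArg card (isPacked_std w)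
  rw [card_image_of_injective _ (std_injective w)] at h
  simpa using h.symm

open Classical in
theorem weakInv_std (H : SimpleGraph (Fin n)) (v : Fin n → ℕ) :
    weakInv H (std v) = strictInv H v := by
  unfold weakInv strictInv
  congr 1
  refine filter_congr fun p _ => ?_
  refine and_congr_right fun h1 => and_congr_right fun _ => ?_
  rw [← not_lt, std_lt_iff]
  omega

open Classical in
/-- The signed sum of `q ^ weakInv` over the refinements of a word collapses to the
standardization of the word. -/
theorem sum_refinements {K : Type*} [CommRing K] (H : SimpleGraph (Fin n)) (q : K)
    (v : Fin n → ℕ) :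
    ∑ u ∈ univ.filter (fun u : PackedWord n => Coarser v u.1),
      (-1 : K) ^ (n - maxLetter u.1) * q ^ weakInv H u.1 = q ^ strictInv H v := by
  rw [← sum_filter_add_sum_filter_not _ (fun u : PackedWord n => ∃ m, Misplaced v u.1 m)]
  have h0 : ∑ u ∈ (univ.filter (fun u : PackedWord n => Coarser v u.1)).filter
      (fun u : PackedWord n => ∃ m, Misplaced v u.1 m),
      (-1 : K) ^ (n - maxLetter u.1) * q ^ weakInv H u.1 = 0 := by
    have hex : ∀ u ∈ (univ.filter (fun u : PackedWord n => Coarser v u.1)).filter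
        (fun u : PackedWord n => ∃ m, Misplaced v u.1 m),
        Coarser v u.1 ∧ ∃ m, LastMisplaced v u.1 m := by
      intro u hu
      simp only [mem_filter, mem_univ, true_and] at hu
      exact ⟨hu.1, exists_lastMisplaced hu.2⟩
    have spec := fun u hu =>
      toggle_spec K u.2 (hex u hu).1 (hex u hu).2.choose_spec
    refine sum_involution (fun u hu => ⟨toggle u.1 (hex u hu).2.choose, (spec u hu).1⟩)
      ?_ ?_ ?_ ?_
    · intro u hu
      have := spec u hu
      simp only [this.2.2.2.2.2.1]
      rw [← add_mul, this.2.2.2.2.1, zero_mul]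
    · intro u hu _ e
      exact (spec u hu).2.2.2.2.2.2 (congrArg Subtype.val e)
    · intro u hu
      simp only [mem_filter, mem_univ, true_and]
      exact ⟨(spec u hu).2.1, _, (spec u hu).2.2.1.1⟩
    · intro u hu
      apply Subtype.ext
      have hmem : (⟨toggle u.1 (hex u hu).2.choose, (spec u hu).1⟩ : PackedWord n) ∈
          (univ.filter (fun u : PackedWord n => Coarser v u.1)).filter
            (fun u : PackedWord n => ∃ m, Misplaced v u.1 m) := by
        simp only [mem_filter, mem_univ, true_and]
        exact ⟨(spec u hu).2.1, _, (spec u hu).2.2.1.1⟩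
      -- The last misplaced position is unique and is kept by the toggle, so the second application
      -- acts at the same position.
      have e := (hex _ hmem).2.choose_spec.unique (spec u hu).2.2.1
      simp only at e ⊢
      rw [e]
      exact (spec u hu).2.2.2.1
  rw [h0, zero_add, sum_eq_single (⟨std v, isPacked_std v⟩ : PackedWord n)]
  · simp [maxLetter_std, weakInv_std]
  · intro u hu hne
    simp only [mem_filter, mem_univ, true_and, not_exists] at hu
    exact absurd (Subtype.ext (hu.1.eq_of_not_misplaced u.2 hu.2)) hne
  · intro h
    refine absurd ?_ h
    simp only [mem_filter, mem_univ, true_and, not_exists]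
    exact ⟨coarser_std v, not_misplaced_std v⟩

end Words

/-! ### Coefficients in `WQSym` -/

section Coefficients

variable {K : Type*} [Field K] {n : ℕ}

theorem WQSym.ext_packed {f g : WQSym K n} (h : ∀ u : PackedWord n, f.1 u.1 = g.1 u.1) :
    f = g := by
  apply Subtype.ext
  funext w
  have e := (isPacked_pack w).pack_eq
  rw [f.2 w (pack w) e.symm, g.2 w (pack w) e.symm]
  exact h ⟨pack w, isPacked_pack w⟩

open Classical in
theorem M_apply (u v : PackedWord n) : (M K u).1 v.1 = if v = u then 1 else 0 := by
  simp only [M, v.2.pack_eq, Subtype.ext_iff]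

theorem WQSym.sum_apply {ι : Type*} (s : Finset ι) (f : ι → WQSym K n) (w : Fin n → ℕ) :
    (∑ i ∈ s, f i).1 w = ∑ i ∈ s, (f i).1 w := by
  have h : ((∑ i ∈ s, f i : WQSym K n) : (Fin n → ℕ) → K) = ∑ i ∈ s, (f i).1 := by
    simp
  rw [h, Finset.sum_apply]

theorem WQSym.smul_apply (c : K) (f : WQSym K n) (w : Fin n → ℕ) :
    (c • f).1 w = c * f.1 w := rfl

open Classical in
theorem WQSym.sum_filter_M_apply (P : PackedWord n → Prop) [DecidablePred P] (v : PackedWord n) :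
    (∑ u ∈ univ.filter P, M K u).1 v.1 = if P v then 1 else 0 := by
  rw [WQSym.sum_apply]
  simp only [M_apply]
  rw [sum_ite_eq]
  simp

open Classical in
theorem Phi_apply (u v : PackedWord n) :
    (Phi K u).1 v.1 = if Coarser u.1 v.1 ∧ std v.1 = std u.1 then 1 else 0 := by
  unfold Phi
  exact WQSym.sum_filter_M_apply (K := K)
    (fun v : PackedWord n => Coarser u.1 v.1 ∧ std v.1 = std u.1) v

open Classical in
theorem omega_apply (f : WQSym K n) (v : PackedWord n) :
    (omega K n f).1 v.1 = ∑ u ∈ univ.filter (fun u : PackedWord n => Coarser v.1 u.1),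
      (-1) ^ (n - maxLetter u.1) * f.1 u.1 := by
  have h : omega K n f = ∑ u : PackedWord n, (f.1 u.1 * (-1) ^ (n - maxLetter u.1)) •
    ∑ v ∈ univ.filter (fun v : PackedWord n => Coarser v.1 u.1), M K v := by
    simp only [omega, LinearMap.coe_mk, AddHom.coe_mk]
  rw [h, WQSym.sum_apply, sum_filter]
  refine sum_congr rfl fun u _ => ?_
  rw [WQSym.smul_apply, WQSym.sum_filter_M_apply (fun v : PackedWord n => Coarser v.1 u.1) v]
  split_ifs <;> ring

open Classical in
theorem LLT_apply (G : SimpleGraph (Fin n)) (q : K) (u : PackedWord n) :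
    (LLT G q).1 u.1 = q ^ asc G u.1 := by
  rw [LLT, WQSym.sum_apply]
  simp only [WQSym.smul_apply, M_apply]
  simp

open Classical in
theorem ncard_edgeSet_eq (G : SimpleGraph (Fin n)) :
    G.edgeSet.ncard =
      (univ.filter (fun p : Fin n × Fin n => p.1 < p.2 ∧ G.Adj p.1 p.2)).card := by
  rw [← Set.ncard_coe_finset]
  symm
  refine Set.ncard_congr (fun p _ => s(p.1, p.2)) ?_ ?_ ?_
  · rintro ⟨a, b⟩ h
    simpa using (by simpa using h : a < b ∧ G.Adj a b).2
  · rintro ⟨a, b⟩ ⟨c, d⟩ h h' e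
    have h1 : a < b ∧ G.Adj a b := by simpa using h
    have h2 : c < d ∧ G.Adj c d := by simpa using h'
    rcases Sym2.eq_iff.1 e with ⟨h3, h4⟩ | ⟨h3, h4⟩
    · simp only at h3 h4
      rw [h3, h4]
    · simp only at h3 h4
      subst h3 h4
      exact absurd h1.1 (not_lt.2 h2.1.le)
  · intro e he
    induction e with
    | _ a b =>
      have h : G.Adj a b := he
      rcases lt_or_gt_of_ne h.ne with hlt | hlt
      · exact ⟨(a, b), by simp [hlt, h], rfl⟩
      · exact ⟨(b, a), by simp [hlt, h.symm], Sym2.eq_swap⟩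

open Classical in
theorem asc_add_weakInv (G : SimpleGraph (Fin n)) (u : Fin n → ℕ) :
    asc G u + weakInv G u = G.edgeSet.ncard := by
  rw [ncard_edgeSet_eq, ← card_filter_add_card_filter_not (fun p : Fin n × Fin n => u p.1 < u p.2),
    filter_filter, filter_filter]
  simp only [asc, weakInv, not_lt, and_assoc]

theorem LLTtilde_apply (G : SimpleGraph (Fin n)) {q : K} (hq : q ≠ 0) (u : PackedWord n) :
    (LLTtilde G q).1 u.1 = q ^ weakInv G u.1 := by
  rw [LLTtilde, WQSym.smul_apply, LLT_apply, ← asc_add_weakInv G u.1, pow_add, inv_pow]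
  field_simp

theorem omega_LLTtilde_apply (G : SimpleGraph (Fin n)) {q : K} (hq : q ≠ 0) (v : PackedWord n) :
    (omega K n (LLTtilde G q)).1 v.1 = q ^ strictInv G v.1 := by
  classical
  rw [omega_apply, ← sum_refinements]
  exact sum_congr rfl fun u _ => by rw [LLTtilde_apply G hq]

/-! ### The minimal destandardization -/

theorem minDestdWord_mono (σ : Equiv.Perm (Fin n)) {i j : Fin n} (h : σ i ≤ σ j) :
    minDestdWord σ i ≤ minDestdWord σ j := by
  unfold minDestdWord
  refine Nat.add_le_add_left (card_le_card fun a => ?_) 1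
  simp only [mem_filter, mem_univ, true_and]
  rintro ⟨b, h1, h2, h3⟩
  exact ⟨b, h1, h2, h3.trans h⟩

/-- Equal letters mean that the count does not grow between the values `σ i` and `σ j`, so each step
to the next value moves to the right. -/
theorem lt_of_minDestdWord_eq (σ : Equiv.Perm (Fin n)) {i j : Fin n} (h : σ i < σ j)
    (he : minDestdWord σ i = minDestdWord σ j) : i < j := by
  obtain ⟨d, hd⟩ : ∃ d, (σ j : ℕ) = σ i + 1 + d := Nat.exists_eq_add_of_le (by
    rw [Fin.lt_def] at h; omega)
  have step : ∀ a b : Fin n, (σ b : ℕ) = σ a + 1 → σ b ≤ σ j → σ i ≤ σ a → a < b := by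
    intro a b h1 h2 h3
    by_contra hcon
    have hne : b ≠ a := by rintro rfl; omega
    have hlt : b < a := lt_of_le_of_ne (not_lt.1 hcon) hne
    refine absurd he (ne_of_lt ?_)
    unfold minDestdWord
    refine Nat.add_lt_add_left (card_lt_card ?_) 1
    rw [Finset.ssubset_iff_of_subset]
    · refine ⟨a, ?_, ?_⟩
      · simp only [mem_filter, mem_univ, true_and]
        exact ⟨b, h1, hlt, h2⟩
      · simp only [mem_filter, mem_univ, true_and, not_exists, not_and]
        intro c hc _ hle
        rw [Fin.le_def] at hle h3
        omega
    · intro c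
      simp only [mem_filter, mem_univ, true_and]
      rintro ⟨e, h4, h5, h6⟩
      exact ⟨e, h4, h5, h6.trans h.le⟩
  have key : ∀ d (b : Fin n), (σ b : ℕ) = σ i + 1 + d → σ b ≤ σ j → i < b := by
    intro d
    induction d with
    | zero => exact fun b h1 h2 => step i b h1 h2 le_rfl
    | succ d ih =>
      intro b h1 h2
      have hb := (σ b).2
      set c : Fin n := σ.symm ⟨σ i + 1 + d, by omega⟩ with hc
      have h3 : (σ c : ℕ) = σ i + 1 + d := by simp [hc]
      have h4 : i < c := ih c h3 (by rw [Fin.le_def] at h2 ⊢; omega)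
      exact h4.trans (step c b (by omega) h2 (by rw [Fin.le_def]; omega))
  exact key d j hd le_rfl

theorem minDestdWord_lex (σ : Equiv.Perm (Fin n)) (i j : Fin n) :
    (minDestdWord σ i < minDestdWord σ j ∨ (minDestdWord σ i = minDestdWord σ j ∧ i ≤ j)) ↔
      σ i ≤ σ j := by
  rcases lt_trichotomy (σ i) (σ j) with h | h | h
  · have h1 := minDestdWord_mono σ h.le
    simp only [h.le, iff_true]
    rcases h1.lt_or_eq with h2 | h2
    · exact Or.inl h2
    · exact Or.inr ⟨h2, (lt_of_minDestdWord_eq σ h h2).le⟩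
  · have := σ.injective h
    subst this
    simp
  · have h1 := minDestdWord_mono σ h.le
    simp only [not_le.2 h, iff_false, not_or, not_lt, not_and, not_le]
    exact ⟨h1, fun e => lt_of_minDestdWord_eq σ h e.symm⟩

theorem standardizes_minDestd (σ : Equiv.Perm (Fin n)) : Standardizes σ (minDestd σ).1 := by
  intro i
  change std (minDestdWord σ) i = _
  unfold std
  have h : univ.filter (fun j => minDestdWord σ j < minDestdWord σ i ∨
      (minDestdWord σ j = minDestdWord σ i ∧ j ≤ i)) = univ.filter (fun j => σ j ≤ σ i) :=
    filter_congr fun j _ => minDestdWord_lex σ j i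
  rw [h]
  have h2 : (univ.filter (fun j => σ j ≤ σ i)).map σ.toEmbedding = Iic (σ i) := by
    ext x
    simp only [mem_map, mem_filter, mem_univ, true_and, Equiv.coe_toEmbedding, mem_Iic]
    constructor
    · rintro ⟨j, h3, rfl⟩; exact h3
    · intro h3; exact ⟨σ.symm x, by simpa using h3, by simp⟩
  rw [← card_map σ.toEmbedding, h2, Fin.card_Iic]

/-- When a value stands to the left of its predecessor, `v` must increase strictly between them.
Hence no such break separates two values lying in one block of `v`. -/
theorem Standardizes.coarser_minDestd {σ : Equiv.Perm (Fin n)} {v : Fin n → ℕ}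
    (h : Standardizes σ v) : Coarser (minDestd σ).1 v := by
  intro i j hij
  change minDestdWord σ i ≤ minDestdWord σ j
  by_cases hσ : σ i ≤ σ j
  · exact minDestdWord_mono σ hσ
  have hσ := not_le.1 hσ
  have hji : v j = v i ∧ j < i := by
    rcases (h.lt_iff j i).1 hσ with h1 | h1
    · omega
    · exact h1
  unfold minDestdWord
  refine Nat.add_le_add_left (card_le_card fun a => ?_) 1
  simp only [mem_filter, mem_univ, true_and]
  rintro ⟨b, h1, h2, h3⟩
  refine ⟨b, h1, h2, ?_⟩
  by_contra hcon
  have hcon := not_le.1 hcon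
  have hab : σ a < σ b := by rw [Fin.lt_def]; omega
  have hja : σ j ≤ σ a := by rw [Fin.lt_def] at hcon; rw [Fin.le_def]; omega
  have e1 : v a < v b := by
    rcases (h.lt_iff a b).1 hab with h4 | h4
    · exact h4
    · exact absurd h4.2 (not_lt.2 h2.le)
  have e2 : v j ≤ v a := by
    by_contra h4
    exact absurd ((h.lt_iff a j).2 (Or.inl (not_le.1 h4))) (not_lt.2 hja)
  have e3 : v b ≤ v i := by
    by_contra h4
    exact absurd ((h.lt_iff i b).2 (Or.inl (not_le.1 h4))) (not_lt.2 h3)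
  omega

theorem Standardizes.eq {σ τ : Equiv.Perm (Fin n)} {v : Fin n → ℕ} (h : Standardizes σ v)
    (h' : Standardizes τ v) : σ = τ := by
  ext i
  have h1 := h i
  have h2 := h' i
  omega

theorem minDestd_injective : Function.Injective (minDestd (n := n)) := by
  intro σ τ h
  have h1 := standardizes_minDestd σ
  rw [h] at h1
  exact h1.eq (standardizes_minDestd τ)

open Classical in
-- The refinement condition in `Phi` is automatic here, because `minDestd` is coarser than every
-- word with its standardization.
theorem Phi_minDestd_apply {σ : Equiv.Perm (Fin n)} {v : PackedWord n} (h : Standardizes σ v.1)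
    (τ : Equiv.Perm (Fin n)) : (Phi K (minDestd τ)).1 v.1 = if τ = σ then 1 else 0 := by
  rw [Phi_apply]
  refine if_congr ?_ rfl rfl
  constructor
  · rintro ⟨-, h2⟩
    have h3 := standardizes_minDestd τ
    unfold Standardizes at h3
    rw [← h2] at h3
    exact Standardizes.eq h3 h
  · rintro rfl
    refine ⟨h.coarser_minDestd, funext fun i => ?_⟩
    rw [h i, standardizes_minDestd τ i]

/-! ### The basis `Φ` -/

variable (K n) in
/-- An element of `WQSym` is given by its coefficients on the packed words. -/
noncomputable def WQSym.equivFun : WQSym K n ≃ₗ[K] (PackedWord n → K) where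
  toFun f u := f.1 u.1
  map_add' _ _ := rfl
  map_smul' _ _ := rfl
  invFun g := ⟨fun w => g ⟨pack w, isPacked_pack w⟩, fun w w' h => by simp only [h]⟩
  left_inv f := WQSym.ext_packed fun u => by simp only [u.2.pack_eq]
  right_inv g := by
    funext u
    simp only [u.2.pack_eq]

theorem finrank_WQSym : Module.finrank K (WQSym K n) = Fintype.card (PackedWord n) := by
  rw [(WQSym.equivFun K n).finrank_eq, Module.finrank_fintype_fun_eq_card]

/-- Triangularity with respect to the sum of the letters: a strictly coarser packed word has a
strictly smaller sum. -/
theorem linearIndependent_Phi : LinearIndependent K (fun u : PackedWord n => Phi K u) := by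
  classical
  rw [Fintype.linearIndependent_iff]
  intro c hc
  have key : ∀ k, ∀ u : PackedWord n, ∑ i, u.1 i = k → c u = 0 := by
    intro k
    induction k using Nat.strong_induction_on with
    | _ k ih =>
      intro u hu
      have h := congrArg (fun f : WQSym K n => f.1 u.1) hc
      simp only [WQSym.sum_apply, WQSym.smul_apply, Phi_apply] at h
      rw [sum_eq_single u] at h
      · simpa [Coarser] using h
      · intro u' _ hne
        by_cases h1 : Coarser u'.1 u.1 ∧ std u.1 = std u'.1
        · rw [ih (∑ i, u'.1 i) _ u' rfl, zero_mul]
          rw [← hu]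
          have hle := fun i => h1.1.le u'.2 u.2 i
          refine sum_lt_sum (fun i _ => hle i) ?_
          by_contra hcon
          push Not at hcon
          exact hne (Subtype.ext (funext fun i => le_antisymm (hle i) (hcon i (mem_univ i))))
        · rw [if_neg h1, mul_zero]
      · intro h1
        exact absurd (mem_univ u) h1
  exact fun u => key _ u rfl

theorem exists_basis_Phi : ∃ B : Module.Basis (PackedWord n) K (WQSym K n), ∀ u, B u = Phi K u := by
  by_cases hne : Nonempty (PackedWord n)
  · exact ⟨basisOfLinearIndependentOfCardEqFinrank linearIndependent_Phi finrank_WQSym.symm,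
      fun u => by simp⟩
  · exact absurd ⟨⟨_, isPacked_pack (fun _ => 0)⟩⟩ hne

end Coefficients

/-! ### Cells in reading order -/

section Cells

variable (μ : YoungDiagram)

theorem readingEmb_cellAt (a : Fin μ.card) :
    readingEmb (cellAt μ a) = (μ.cells.map readingEmb).orderEmbOfFin (card_map _) a := rfl

theorem cellAt_mem (a : Fin μ.card) : cellAt μ a ∈ μ.cells := by
  have h := orderEmbOfFin_mem (μ.cells.map readingEmb) (card_map _) a
  rw [← readingEmb_cellAt] at h
  exact (mem_map' readingEmb).1 h

theorem exists_cellAt_eq {c : ℕ × ℕ} (hc : c ∈ μ.cells) : ∃ a, cellAt μ a = c := by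
  have h : readingEmb c ∈ Set.range ((μ.cells.map readingEmb).orderEmbOfFin (card_map _)) := by
    rw [range_orderEmbOfFin]
    exact mem_coe.2 (mem_map_of_mem _ hc)
  obtain ⟨a, ha⟩ := h
  rw [← readingEmb_cellAt] at ha
  exact ⟨a, readingEmb.injective ha⟩

theorem cellAt_lt_iff (a b : Fin μ.card) :
    a < b ↔ (cellAt μ b).1 < (cellAt μ a).1 ∨
      ((cellAt μ a).1 = (cellAt μ b).1 ∧ (cellAt μ a).2 < (cellAt μ b).2) := by
  rw [← ((μ.cells.map readingEmb).orderEmbOfFin (card_map _)).lt_iff_lt, ← readingEmb_cellAt,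
    ← readingEmb_cellAt]
  change toLex (OrderDual.toDual (cellAt μ a).1, (cellAt μ a).2) <
    toLex (OrderDual.toDual (cellAt μ b).1, (cellAt μ b).2) ↔ _
  rw [Prod.Lex.toLex_lt_toLex]
  simp

theorem cellAt_injective : Function.Injective (cellAt μ) := by
  intro a b h
  have h1 := cellAt_lt_iff μ a b
  have h2 := cellAt_lt_iff μ b a
  rw [h] at h1 h2
  simp at h1 h2
  exact le_antisymm h2 h1

theorem map_cellAt : univ.map ⟨cellAt μ, cellAt_injective μ⟩ = μ.cells := by
  ext c
  simp only [mem_map, mem_univ, true_and, Function.Embedding.coeFn_mk]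
  constructor
  · rintro ⟨a, rfl⟩; exact cellAt_mem μ a
  · exact exists_cellAt_eq μ

theorem sum_filter_cellAt (P : ℕ × ℕ → Prop) [DecidablePred P] (f : ℕ × ℕ → ℕ) :
    ∑ a ∈ univ.filter (fun a => P (cellAt μ a)), f (cellAt μ a) =
      ∑ c ∈ μ.cells.filter P, f c := by
  rw [sum_filter, sum_filter, ← map_cellAt, sum_map]
  rfl

theorem card_filter_cellAt (P : ℕ × ℕ → Prop) [DecidablePred P] :
    (univ.filter (fun a => P (cellAt μ a))).card = (μ.cells.filter P).card := by
  simpa using sum_filter_cellAt μ P (fun _ => 1)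

theorem sum_row (i : ℕ) (f : ℕ × ℕ → ℕ) :
    ∑ c ∈ μ.cells.filter (fun c => c.1 = i), f c = ∑ j ∈ range (μ.rowLen i), f (i, j) := by
  symm
  refine sum_nbij' (fun j => (i, j)) (fun c => c.2) ?_ ?_ ?_ ?_ ?_
  · intro j hj
    simp only [mem_filter, YoungDiagram.mem_cells, and_true]
    exact YoungDiagram.mem_iff_lt_rowLen.2 (mem_range.1 hj)
  · rintro ⟨a, b⟩ h
    simp only [mem_filter, YoungDiagram.mem_cells] at h
    obtain ⟨h1, rfl⟩ := h
    exact mem_range.2 (YoungDiagram.mem_iff_lt_rowLen.1 h1)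
  · intro j _; rfl
  · rintro ⟨a, b⟩ h
    simp only [mem_filter] at h
    rw [← h.2]
  · intro j _; rfl

/-- The labels of the cells outside the bottom row. -/
def upper : Finset (Fin μ.card) := univ.filter (fun a => 0 < (cellAt μ a).1)

theorem mem_upper {a : Fin μ.card} : a ∈ upper μ ↔ 0 < (cellAt μ a).1 := by simp [upper]

theorem card_upper : (upper μ).card = μ.card - μ.rowLen 0 := by
  have h1 := card_filter_add_card_filter_not (s := (univ : Finset (Fin μ.card)))
    (fun a => (cellAt μ a).1 = 0)
  have h2 := card_filter_cellAt μ (fun c => c.1 = 0)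
  have h3 := sum_row μ 0 (fun _ => 1)
  have h4 : univ.filter (fun a => ¬ (cellAt μ a).1 = 0) = upper μ :=
    filter_congr fun a _ => by omega
  rw [h4] at h1
  simp at h1 h3
  omega

/-- Reversing each row exchanges the arm of a cell with its column index. -/
theorem sum_arm : ∑ c ∈ μ.cells, arm μ c = nStat μ.transpose := by
  have h : nStat μ.transpose = ∑ c ∈ μ.cells, c.2 := by
    refine sum_nbij' Prod.swap Prod.swap ?_ ?_ ?_ ?_ ?_ <;> rintro ⟨a, b⟩ <;> simp
  rw [h]
  have key : ∀ c ∈ μ.cells, c.2 < μ.rowLen c.1 := fun c hc =>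
    YoungDiagram.mem_iff_lt_rowLen.1 ((YoungDiagram.mem_cells _).1 hc)
  refine sum_nbij' (fun c => (c.1, arm μ c)) (fun c => (c.1, arm μ c)) ?_ ?_ ?_ ?_ ?_
  · intro c hc
    have := key c hc
    rw [YoungDiagram.mem_cells, YoungDiagram.mem_iff_lt_rowLen, arm]
    omega
  · intro c hc
    have := key c hc
    rw [YoungDiagram.mem_cells, YoungDiagram.mem_iff_lt_rowLen, arm]
    omega
  · intro c hc
    have := key c hc
    simp only [arm]
    ext <;> simp only
    omega
  · intro c hc
    have := key c hc
    simp only [arm]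
    ext <;> simp only
    omega
  · intro c _; rfl

/-- The arms in the bottom row are `0, …, μ₁ - 1`, which accounts for the binomial coefficient in
the prefactor of `Hmu`. -/
theorem sum_arm_upper :
    ∑ a ∈ upper μ, arm μ (cellAt μ a) + (μ.rowLen 0).choose 2 = nStat μ.transpose := by
  rw [← sum_arm, ← sum_filter_not_add_sum_filter μ.cells (fun c => c.1 = 0), sum_row, upper,
    sum_filter_cellAt μ (fun c => 0 < c.1) (arm μ)]
  congr 1
  · exact sum_congr (filter_congr fun c _ => by omega) fun _ _ => rfl
  · rw [Nat.choose_two_right, ← Finset.sum_range_id, ← sum_range_reflect]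
    refine sum_congr rfl fun j _ => ?_
    simp only [arm]
    omega

variable {μ}

/-! ### Vertical edges -/

theorem IsSouth.lt {a b : Fin μ.card} (h : IsSouth μ a b) : a < b :=
  (cellAt_lt_iff μ a b).2 (Or.inl (by have := h.1; omega))

theorem IsSouth.mem_upper {a b : Fin μ.card} (h : IsSouth μ a b) : a ∈ upper μ :=
  (NCMacdonald.mem_upper μ).2 (by have := h.1; omega)

theorem IsSouth.right_unique {a b c : Fin μ.card} (h : IsSouth μ a b) (h' : IsSouth μ a c) :
    b = c :=
  cellAt_injective μ (Prod.ext (by have := h.1; have := h'.1; omega) (h.2.symm.trans h'.2))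

theorem IsSouth.left_unique {a b c : Fin μ.card} (h : IsSouth μ a c) (h' : IsSouth μ b c) :
    a = b :=
  cellAt_injective μ (Prod.ext (by have := h.1; have := h'.1; omega) (h.2.trans h'.2.symm))

theorem exists_isSouth {a : Fin μ.card} (h : a ∈ upper μ) : ∃ b, IsSouth μ a b := by
  have h0 := (mem_upper μ).1 h
  obtain ⟨b, hb⟩ := exists_cellAt_eq μ (c := ((cellAt μ a).1 - 1, (cellAt μ a).2)) (by
    rw [YoungDiagram.mem_cells]
    exact μ.up_left_mem (Nat.sub_le _ _) le_rfl ((YoungDiagram.mem_cells _).1 (cellAt_mem μ a)))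
  refine ⟨b, ?_, ?_⟩
  · rw [hb]; simp only; omega
  · rw [hb]

theorem graph_adj_iff {a b : Fin μ.card} (h : a < b) :
    (graph μ).Adj a b ↔ Attacks (cellAt μ a) (cellAt μ b) := by
  rw [graph, SimpleGraph.fromRel_adj]
  constructor
  · rintro ⟨-, h1 | h1⟩
    · exact h1
    · rw [cellAt_lt_iff] at h
      unfold Attacks at h1
      omega
  · exact fun h1 => ⟨h.ne, Or.inl h1⟩

theorem IsSouth.not_adj {a b : Fin μ.card} (h : IsSouth μ a b) : ¬ (graph μ).Adj a b := by
  rw [graph_adj_iff h.lt]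
  have := h.1
  have := h.2
  unfold Attacks
  omega

theorem graphPlus_adj_iff {a b : Fin μ.card} (h : a < b) :
    (graphPlus μ).Adj a b ↔ (graph μ).Adj a b ∨ IsSouth μ a b := by
  rw [graphPlus, SimpleGraph.sup_adj, SimpleGraph.fromRel_adj]
  constructor
  · rintro (h1 | ⟨-, h1 | h1⟩)
    · exact Or.inl h1
    · exact Or.inr h1
    · exact absurd h (not_lt.2 h1.lt.le)
  · rintro (h1 | h1)
    · exact Or.inl h1
    · exact Or.inr ⟨h.ne, Or.inl h1⟩

theorem mem_upperCells {H : SimpleGraph (Fin μ.card)} {a : Fin μ.card} :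
    a ∈ upperCells μ H ↔ ∃ b, IsSouth μ a b ∧ H.Adj a b := by
  simp [upperCells]

theorem IsSouth.mem_upperCells_iff {a b : Fin μ.card} (h : IsSouth μ a b)
    {H : SimpleGraph (Fin μ.card)} : a ∈ upperCells μ H ↔ H.Adj a b := by
  rw [mem_upperCells]
  constructor
  · rintro ⟨c, h1, h2⟩
    rwa [h.right_unique h1]
  · exact fun h1 => ⟨b, h, h1⟩

theorem adj_iff_of_mem_interval {H : SimpleGraph (Fin μ.card)} (h1 : graph μ ≤ H)
    (h2 : H ≤ graphPlus μ) {a b : Fin μ.card} (hab : a < b) :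
    H.Adj a b ↔ (graph μ).Adj a b ∨ (IsSouth μ a b ∧ a ∈ upperCells μ (H \ graph μ)) := by
  constructor
  · intro h
    rcases (graphPlus_adj_iff hab).1 (h2 h) with h3 | h3
    · exact Or.inl h3
    · refine Or.inr ⟨h3, h3.mem_upperCells_iff.2 ?_⟩
      rw [SimpleGraph.sdiff_adj]
      exact ⟨h, h3.not_adj⟩
  · rintro (h | ⟨h3, h4⟩)
    · exact h1 h
    · have := h3.mem_upperCells_iff.1 h4
      rw [SimpleGraph.sdiff_adj] at this
      exact this.1

theorem upperCells_subset (H : SimpleGraph (Fin μ.card)) : upperCells μ H ⊆ upper μ := by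
  intro a ha
  obtain ⟨b, h, -⟩ := mem_upperCells.1 ha
  exact h.mem_upper

theorem upperCells_graphPlus_sdiff {H : SimpleGraph (Fin μ.card)} :
    upperCells μ (graphPlus μ \ H) = upper μ \ upperCells μ (H \ graph μ) := by
  ext a
  rw [mem_sdiff]
  constructor
  · intro h
    obtain ⟨b, hs, h1⟩ := mem_upperCells.1 h
    rw [SimpleGraph.sdiff_adj] at h1
    refine ⟨hs.mem_upper, fun h2 => h1.2 ?_⟩
    have := hs.mem_upperCells_iff.1 h2
    rw [SimpleGraph.sdiff_adj] at this
    exact this.1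
  · rintro ⟨h1, h2⟩
    obtain ⟨b, hs⟩ := exists_isSouth h1
    rw [hs.mem_upperCells_iff, SimpleGraph.sdiff_adj] at h2 ⊢
    exact ⟨(graphPlus_adj_iff hs.lt).2 (Or.inr hs), fun h => h2 ⟨h, hs.not_adj⟩⟩

variable (μ) in
/-- The graph `G_μ` together with the vertical edges below the cells of `S`. -/
def graphWith (S : Finset (Fin μ.card)) : SimpleGraph (Fin μ.card) :=
  graph μ ⊔ SimpleGraph.fromRel (fun a b => IsSouth μ a b ∧ a ∈ S)

theorem graph_le_graphWith (S : Finset (Fin μ.card)) : graph μ ≤ graphWith μ S := le_sup_left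

theorem graphWith_le_graphPlus (S : Finset (Fin μ.card)) : graphWith μ S ≤ graphPlus μ := by
  refine sup_le_sup_left (fun a b h => ?_) _
  rw [SimpleGraph.fromRel_adj] at h ⊢
  exact ⟨h.1, h.2.imp And.left And.left⟩

theorem graphWith_adj_iff {S : Finset (Fin μ.card)} {a b : Fin μ.card} (h : a < b) :
    (graphWith μ S).Adj a b ↔ (graph μ).Adj a b ∨ (IsSouth μ a b ∧ a ∈ S) := by
  rw [graphWith, SimpleGraph.sup_adj, SimpleGraph.fromRel_adj]
  constructor
  · rintro (h1 | ⟨-, h1 | h1⟩)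
    · exact Or.inl h1
    · exact Or.inr h1
    · exact absurd h (not_lt.2 h1.1.lt.le)
  · rintro (h1 | h1)
    · exact Or.inl h1
    · exact Or.inr ⟨h.ne, Or.inl h1⟩

theorem upperCells_graphWith {S : Finset (Fin μ.card)} (hS : S ⊆ upper μ) :
    upperCells μ (graphWith μ S \ graph μ) = S := by
  ext a
  constructor
  · intro h
    obtain ⟨b, hs, h1⟩ := mem_upperCells.1 h
    rw [SimpleGraph.sdiff_adj, graphWith_adj_iff hs.lt] at h1
    exact (h1.1.resolve_left h1.2).2
  · intro h
    obtain ⟨b, hs⟩ := exists_isSouth (hS h)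
    rw [hs.mem_upperCells_iff, SimpleGraph.sdiff_adj, graphWith_adj_iff hs.lt]
    exact ⟨Or.inr ⟨hs, h⟩, hs.not_adj⟩

theorem simpleGraph_ext_of_lt {n : ℕ} {H H' : SimpleGraph (Fin n)}
    (h : ∀ a b, a < b → (H.Adj a b ↔ H'.Adj a b)) : H = H' := by
  ext a b
  rcases lt_trichotomy a b with h1 | h1 | h1
  · exact h a b h1
  · subst h1; simp
  · rw [H.adj_comm, H'.adj_comm]; exact h b a h1

theorem graphWith_upperCells {H : SimpleGraph (Fin μ.card)} (h1 : graph μ ≤ H)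
    (h2 : H ≤ graphPlus μ) : graphWith μ (upperCells μ (H \ graph μ)) = H :=
  simpleGraph_ext_of_lt fun a b hab => by
    rw [graphWith_adj_iff hab, adj_iff_of_mem_interval h1 h2 hab]

open Classical in
-- The interval of graphs is Boolean: a graph is determined by the upper cells of its vertical
-- edges, which can be chosen freely.
theorem sum_interval_eq_sum_powerset {R : Type*} [AddCommMonoid R]
    (F : Finset (Fin μ.card) → R) :
    ∑ H ∈ univ.filter (fun H : SimpleGraph (Fin μ.card) => graph μ ≤ H ∧ H ≤ graphPlus μ),
      F (upperCells μ (H \ graph μ)) = ∑ S ∈ (upper μ).powerset, F S := by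
  refine sum_bij' (fun H _ => upperCells μ (H \ graph μ)) (fun S _ => graphWith μ S)
    ?_ ?_ ?_ ?_ ?_
  · exact fun H _ => mem_powerset.2 (upperCells_subset _)
  · exact fun S _ => mem_filter.2 ⟨mem_univ _, graph_le_graphWith S, graphWith_le_graphPlus S⟩
  · intro H hH
    have := (mem_filter.1 hH).2
    exact graphWith_upperCells this.1 this.2
  · exact fun S hS => upperCells_graphWith (mem_powerset.1 hS)
  · exact fun H _ => rfl

/-- The letter of `v` in the cell `a` is larger than the letter just below. -/
def IsDescent (v : Fin μ.card → ℕ) (a : Fin μ.card) : Prop := ∃ b, IsSouth μ a b ∧ v b < v a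

open Classical in
theorem strictInv_of_mem_interval {H : SimpleGraph (Fin μ.card)} (h1 : graph μ ≤ H)
    (h2 : H ≤ graphPlus μ) (v : Fin μ.card → ℕ) :
    strictInv H v = strictInv (graph μ) v +
      ((upperCells μ (H \ graph μ)).filter (IsDescent v)).card := by
  have e : ((upperCells μ (H \ graph μ)).filter (IsDescent v)).card =
      (univ.filter (fun p : Fin μ.card × Fin μ.card =>
        IsSouth μ p.1 p.2 ∧ p.1 ∈ upperCells μ (H \ graph μ) ∧ v p.2 < v p.1)).card := by
    symm
    refine card_bij (fun p _ => p.1) ?_ ?_ ?_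
    · intro p hp
      simp only [mem_filter, mem_univ, true_and] at hp ⊢
      exact ⟨hp.2.1, p.2, hp.1, hp.2.2⟩
    · rintro ⟨a, b⟩ hp ⟨c, d⟩ hp' hac
      simp only [mem_filter, mem_univ, true_and] at hp hp' hac
      subst hac
      rw [hp.1.right_unique hp'.1]
    · intro a ha
      obtain ⟨h3, b, h4, h5⟩ := mem_filter.1 ha
      exact ⟨(a, b), by simp only [mem_filter, mem_univ, true_and]; exact ⟨h4, h3, h5⟩, rfl⟩
  rw [e, strictInv, strictInv, ← card_union_of_disjoint]
  · congr 1
    ext ⟨a, b⟩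
    simp only [mem_filter, mem_univ, true_and, mem_union]
    constructor
    · rintro ⟨h3, h4, h5⟩
      rcases (adj_iff_of_mem_interval h1 h2 h3).1 h4 with h6 | h6
      · exact Or.inl ⟨h3, h6, h5⟩
      · exact Or.inr ⟨h6.1, h6.2, h5⟩
    · rintro (⟨h3, h4, h5⟩ | ⟨h3, h4, h5⟩)
      · exact ⟨h3, h1 h4, h5⟩
      · exact ⟨h3.lt, (adj_iff_of_mem_interval h1 h2 h3.lt).2 (Or.inr ⟨h3, h4⟩), h5⟩
  · rw [disjoint_left]
    rintro ⟨a, b⟩ h3 h4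
    simp only [mem_filter, mem_univ, true_and] at h3 h4
    exact h4.1.not_adj h3.2.1

end Cells

/-! ### The coefficients of the Macdonald function -/

section Macdonald

variable {K : Type*} [Field K] {μ : YoungDiagram}

open Classical in
-- This is the expansion of a product of binomials over subsets, each chosen descent carrying an
-- extra `q`.
theorem sum_interval {q : K} (f g : Fin μ.card → K) (v : Fin μ.card → ℕ) :
    ∑ H ∈ univ.filter (fun H : SimpleGraph (Fin μ.card) => graph μ ≤ H ∧ H ≤ graphPlus μ),
      ((∏ a ∈ upperCells μ (H \ graph μ), f a) * ∏ a ∈ upperCells μ (graphPlus μ \ H), g a) *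
        q ^ strictInv H v =
    q ^ strictInv (graph μ) v *
      ∏ a ∈ upper μ, (f a * (if IsDescent v a then q else 1) + g a) := by
  rw [prod_add, mul_sum, ← sum_interval_eq_sum_powerset]
  refine sum_congr rfl fun H hH => ?_
  have hH := (mem_filter.1 hH).2
  rw [strictInv_of_mem_interval hH.1 hH.2, upperCells_graphPlus_sdiff, prod_mul_distrib, pow_add,
    ← prod_filter, prod_const]
  ring

variable {σ : Equiv.Perm (Fin μ.card)} {v : Fin μ.card → ℕ}

theorem Standardizes.lt_iff_of_lt {n : ℕ} {σ : Equiv.Perm (Fin n)} {v : Fin n → ℕ}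
    (h : Standardizes σ v) {a b : Fin n} (hab : a < b) : σ b < σ a ↔ v b < v a := by
  rw [h.lt_iff]
  have := hab.le
  constructor
  · rintro (h1 | h1)
    · exact h1
    · exact absurd h1.2 (not_lt.2 this)
  · exact Or.inl

open Classical in
theorem Standardizes.strictInv_eq (h : Standardizes σ v) : strictInv (graph μ) v = Inv μ σ := by
  unfold strictInv Inv
  congr 1
  exact filter_congr fun p _ => and_congr_right fun h1 => and_congr_right fun _ =>
    (h.lt_iff_of_lt h1).symm

theorem mem_Des {a : Fin μ.card} : a ∈ Des μ σ ↔ ∃ b, IsSouth μ a b ∧ σ b < σ a := by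
  simp [Des]

theorem mem_Asc {a : Fin μ.card} : a ∈ Asc μ σ ↔ ∃ b, IsSouth μ a b ∧ σ a < σ b := by
  simp [Asc]

open Classical in
theorem Standardizes.filter_isDescent (h : Standardizes σ v) :
    (upper μ).filter (IsDescent v) = Des μ σ := by
  ext a
  rw [mem_filter, mem_Des]
  constructor
  · rintro ⟨-, b, h1, h2⟩
    exact ⟨b, h1, (h.lt_iff_of_lt h1.lt).2 h2⟩
  · rintro ⟨b, h1, h2⟩
    exact ⟨h1.mem_upper, b, h1, (h.lt_iff_of_lt h1.lt).1 h2⟩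

open Classical in
theorem Standardizes.filter_not_isDescent (h : Standardizes σ v) :
    (upper μ).filter (fun a => ¬ IsDescent v a) = Asc μ σ := by
  ext a
  rw [mem_filter, mem_Asc]
  constructor
  · rintro ⟨h0, h1⟩
    obtain ⟨b, hb⟩ := exists_isSouth h0
    refine ⟨b, hb, lt_of_le_of_ne (not_lt.1 fun h2 => h1 ⟨b, hb, (h.lt_iff_of_lt hb.lt).1 h2⟩) ?_⟩
    exact fun e => hb.lt.ne (σ.injective e)
  · rintro ⟨b, h1, h2⟩
    refine ⟨h1.mem_upper, ?_⟩
    rintro ⟨c, h3, h4⟩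
    rw [← h1.right_unique h3] at h4
    exact absurd h2 (not_lt.2 ((h.lt_iff_of_lt h1.lt).2 h4).le)

variable (μ) in
/-- The coefficient of `Φ_{min(σ)}` in the Macdonald function. -/
noncomputable def coeffH (q : K) (t : ℕ → K) (σ : Equiv.Perm (Fin μ.card)) : K :=
  q ^ Inv μ σ * (∏ a ∈ Asc μ σ, t (1 + leg μ (cellAt μ a))) *
    ∏ a ∈ Des μ σ, (q ^ arm μ (cellAt μ a))⁻¹

theorem Hmu_apply {q : K} (hq0 : q ≠ 0) (hq1 : q ≠ 1) (t : ℕ → K) (v : PackedWord μ.card)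
    (h : Standardizes σ v.1) : (Hmu μ q t).1 v.1 = coeffH μ q t σ := by
  classical
  have hfac : ∀ a, (1 - t (1 + leg μ (cellAt μ a)) * q ^ arm μ (cellAt μ a)) *
      (if IsDescent v.1 a then q else 1) +
      (t (1 + leg μ (cellAt μ a)) * q ^ (arm μ (cellAt μ a) + 1) - 1) =
      (q - 1) * (if IsDescent v.1 a then 1 else
        t (1 + leg μ (cellAt μ a)) * q ^ arm μ (cellAt μ a)) := by
    intro a
    split_ifs <;> ring
  have hq1' : q - 1 ≠ 0 := sub_ne_zero.2 hq1
  have hpow : q ^ (-(nStat μ.transpose : ℤ) + ((μ.rowLen 0).choose 2 : ℤ)) =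
      (∏ a ∈ Des μ σ, (q ^ arm μ (cellAt μ a))⁻¹) * (∏ a ∈ Asc μ σ, q ^ arm μ (cellAt μ a))⁻¹ := by
    rw [← sum_arm_upper, prod_inv_distrib, ← mul_inv, ← h.filter_isDescent,
      ← h.filter_not_isDescent, prod_filter_mul_prod_filter_not, prod_pow_eq_pow_sum,
      ← zpow_natCast, ← zpow_neg]
    congr 1
    push_cast
    ring
  have hA : (∏ a ∈ Asc μ σ, q ^ arm μ (cellAt μ a)) ≠ 0 :=
    prod_ne_zero_iff.2 fun a _ => pow_ne_zero _ hq0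
  rw [Hmu, WQSym.smul_apply, WQSym.sum_apply]
  simp only [WQSym.smul_apply, omega_LLTtilde_apply _ hq0]
  rw [sum_interval, prod_congr rfl fun a _ => hfac a, prod_mul_distrib, prod_const, card_upper,
    prod_ite, prod_const_one, one_mul, h.filter_not_isDescent, prod_mul_distrib, hpow,
    h.strictInv_eq, coeffH]
  have hp : (q - 1) ^ (μ.card - μ.rowLen 0) ≠ 0 := pow_ne_zero _ hq1'
  generalize (∏ a ∈ Asc μ σ, q ^ arm μ (cellAt μ a)) = A at hA ⊢
  generalize (q - 1) ^ (μ.card - μ.rowLen 0) = B at hp ⊢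
  field_simp

theorem Hmu_eq_sum {q : K} (hq0 : q ≠ 0) (hq1 : q ≠ 1) (t : ℕ → K) :
    Hmu μ q t = ∑ σ, coeffH μ q t σ • Phi K (minDestd σ) := by
  classical
  refine WQSym.ext_packed fun v => ?_
  obtain ⟨τ, hτ⟩ := exists_standardizes v.1
  rw [Hmu_apply hq0 hq1 t v hτ, WQSym.sum_apply]
  simp only [WQSym.smul_apply, Phi_minDestd_apply hτ]
  simp

/-! ### Monomiality -/

theorem arm_eq_card (a : Fin μ.card) : arm μ (cellAt μ a) =
    (univ.filter (fun b => (cellAt μ b).1 = (cellAt μ a).1 ∧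
      (cellAt μ a).2 < (cellAt μ b).2)).card := by
  rw [card_filter_cellAt μ (fun c => c.1 = (cellAt μ a).1 ∧ (cellAt μ a).2 < c.2),
    ← filter_filter, card_filter, sum_row, ← card_filter]
  have e : (range (μ.rowLen (cellAt μ a).1)).filter (fun j => (cellAt μ a).2 < j) =
      Ico ((cellAt μ a).2 + 1) (μ.rowLen (cellAt μ a).1) := by
    ext j
    simp only [mem_filter, mem_range, mem_Ico]
    omega
  rw [e, Nat.card_Ico, arm]

/-- For a descent `a` with cell `s a` below it and `w` to its right in the row, `σ (s a) < σ a`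
gives `σ w < σ a` or `σ (s a) < σ w`. Both pairs are attacking, and the resulting map from pairs
`(a, w)` to inversions is injective. -/
theorem sum_arm_Des_le_Inv (σ : Equiv.Perm (Fin μ.card)) :
    ∑ a ∈ Des μ σ, arm μ (cellAt μ a) ≤ Inv μ σ := by
  classical
  have hsouth : ∀ a : Fin μ.card, ∃ b, a ∈ Des μ σ → IsSouth μ a b ∧ σ b < σ a := by
    intro a
    by_cases h : a ∈ Des μ σ
    · obtain ⟨b, hb⟩ := mem_Des.1 h
      exact ⟨b, fun _ => hb⟩
    · exact ⟨a, fun h' => absurd h' h⟩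
  choose s hs using hsouth
  simp only [arm_eq_card]
  rw [← card_sigma]
  unfold Inv
  refine card_le_card_of_injOn
    (fun p => if σ p.2 < σ p.1 then (p.1, p.2) else (p.2, s p.1)) ?_ ?_
  · rintro ⟨a, w⟩ hp
    simp only [coe_sigma, Set.mem_sigma_iff, mem_coe, mem_filter, mem_univ, true_and] at hp
    obtain ⟨ha, h1, h2⟩ := hp
    obtain ⟨h3, h4⟩ := hs a ha
    have h5 := h3.1
    have h6 := h3.2
    simp only [mem_coe, mem_filter, mem_univ, true_and]
    split_ifs with hlt
    · have haw : a < w := (cellAt_lt_iff μ _ _).2 (Or.inr ⟨h1.symm, h2⟩)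
      exact ⟨haw, (graph_adj_iff haw).2 (Or.inl ⟨h1.symm, h2⟩), hlt⟩
    · have hws : w < s a := (cellAt_lt_iff μ _ _).2 (Or.inl (by omega))
      exact ⟨hws, (graph_adj_iff hws).2 (Or.inr ⟨by omega, by omega⟩),
        h4.trans_le (not_lt.1 hlt)⟩
  · rintro ⟨a, w⟩ hp ⟨a', w'⟩ hp' e
    simp only [coe_sigma, Set.mem_sigma_iff, mem_coe, mem_filter, mem_univ, true_and] at hp hp'
    obtain ⟨ha, h1, h2⟩ := hp
    obtain ⟨ha', h1', h2'⟩ := hp'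
    have h3 := (hs a ha).1
    have h3' := (hs a' ha').1
    have h4 := h3.1
    have h4' := h3'.1
    simp only at e
    -- Inversions of the two kinds never coincide: the first lie in one row, the second in
    -- consecutive rows. In the second kind, `a` is recovered as the cell above `s a`.
    split_ifs at e <;> simp only [Prod.mk.injEq] at e
    · rw [e.1, e.2]
    · rw [e.1] at h1
      rw [e.2] at h1
      omega
    · rw [← e.1] at h1'
      rw [← e.2] at h1'
      omega
    · rw [← e.2] at h3'
      rw [h3.left_unique h3', e.1]

/-- Here `1 + leg` is the column length minus the row index, and that index is at least `1`; so only
`t_1, …, t_{r-1}` occur. -/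
theorem leg_mem_of_mem_upper {a : Fin μ.card} (ha : a ∈ upper μ) :
    1 + leg μ (cellAt μ a) ∈ Icc 1 (μ.colLen 0 - 1) := by
  have h0 := (mem_upper μ).1 ha
  have h1 : (cellAt μ a).1 < μ.colLen (cellAt μ a).2 :=
    YoungDiagram.mem_iff_lt_colLen.1 ((YoungDiagram.mem_cells _).1 (cellAt_mem μ a))
  have h2 := μ.colLen_anti 0 (cellAt μ a).2 (Nat.zero_le _)
  rw [mem_Icc, leg]
  omega

theorem Asc_subset_upper : Asc μ σ ⊆ upper μ := by
  intro a ha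
  obtain ⟨b, h, -⟩ := mem_Asc.1 ha
  exact h.mem_upper

theorem prod_Asc_eq (t : ℕ → K) (σ : Equiv.Perm (Fin μ.card)) :
    ∏ a ∈ Asc μ σ, t (1 + leg μ (cellAt μ a)) =
      ∏ i ∈ Icc 1 (μ.colLen 0 - 1), t i ^ ascLeg μ σ i := by
  classical
  rw [← prod_fiberwise_of_maps_to (g := fun a => 1 + leg μ (cellAt μ a))
    (fun a ha => leg_mem_of_mem_upper (Asc_subset_upper ha))]
  refine prod_congr rfl fun i _ => ?_
  rw [prod_congr rfl fun a ha => by rw [(mem_filter.1 ha).2], prod_const, ascLeg]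

theorem coeffH_eq {q : K} (hq0 : q ≠ 0) (t : ℕ → K) (σ : Equiv.Perm (Fin μ.card)) :
    coeffH μ q t σ = q ^ (Inv μ σ - ∑ a ∈ Des μ σ, arm μ (cellAt μ a)) *
      ∏ i ∈ Icc 1 (μ.colLen 0 - 1), t i ^ ascLeg μ σ i := by
  rw [coeffH, prod_Asc_eq, prod_inv_distrib, prod_pow_eq_pow_sum,
    pow_sub₀ q hq0 (sum_arm_Des_le_Inv σ)]
  ring

end Macdonald

end NCMacdonald

theorem mainTheorem9 {K : Type*} [Field K] (q : K) (hq0 : q ≠ 0) (hq1 : q ≠ 1) (t : ℕ → K)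
    (μ : YoungDiagram) :
    NCMacdonald.Hmu μ q t =
      ∑ σ : Equiv.Perm (Fin μ.card),
        (q ^ NCMacdonald.Inv μ σ *
          (∏ a ∈ NCMacdonald.Asc μ σ,
            t (1 + NCMacdonald.leg μ (NCMacdonald.cellAt μ a))) *
          ∏ a ∈ NCMacdonald.Des μ σ,
            (q ^ NCMacdonald.arm μ (NCMacdonald.cellAt μ a))⁻¹) •
        NCMacdonald.Phi K (NCMacdonald.minDestd σ) ∧
    ∃ B : Module.Basis (NCMacdonald.PackedWord μ.card) K (NCMacdonald.WQSym K μ.card),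
      (∀ u, B u = NCMacdonald.Phi K u) ∧
      (∀ σ : Equiv.Perm (Fin μ.card), ∃ e : ℕ,
        (e : ℤ) = (NCMacdonald.Inv μ σ : ℤ) -
          ∑ a ∈ NCMacdonald.Des μ σ, (NCMacdonald.arm μ (NCMacdonald.cellAt μ a) : ℤ) ∧
        B.repr (NCMacdonald.Hmu μ q t) (NCMacdonald.minDestd σ) =
          q ^ e * ∏ i ∈ Finset.Icc 1 (μ.colLen 0 - 1), t i ^ NCMacdonald.ascLeg μ σ i) ∧
      (∀ u : NCMacdonald.PackedWord μ.card, (∀ σ, u ≠ NCMacdonald.minDestd σ) →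
        B.repr (NCMacdonald.Hmu μ q t) u = 0) := by
  classical
  have hH := NCMacdonald.Hmu_eq_sum (μ := μ) hq0 hq1 t
  obtain ⟨B, hB⟩ := NCMacdonald.exists_basis_Phi (K := K) (n := μ.card)
  have hrepr : ∀ u, B.repr (NCMacdonald.Hmu μ q t) u =
      ∑ σ, if NCMacdonald.minDestd σ = u then NCMacdonald.coeffH μ q t σ else 0 := by
    intro u
    rw [hH, map_sum, Finsupp.finsetSum_apply]
    refine Finset.sum_congr rfl fun σ _ => ?_
    rw [← hB, map_smul, B.repr_self, Finsupp.smul_apply, Finsupp.single_apply, smul_eq_mul]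
    split_ifs <;> simp
  refine ⟨hH, B, hB, fun σ => ?_, fun u hu => ?_⟩
  · refine ⟨NCMacdonald.Inv μ σ - ∑ a ∈ NCMacdonald.Des μ σ,
      NCMacdonald.arm μ (NCMacdonald.cellAt μ a), ?_, ?_⟩
    · rw [Nat.cast_sub (NCMacdonald.sum_arm_Des_le_Inv σ)]
      push_cast
      rfl
    · rw [hrepr, ← NCMacdonald.coeffH_eq hq0 t σ]
      simp [NCMacdonald.minDestd_injective.eq_iff]
  · rw [hrepr]
    exact Finset.sum_eq_zero fun σ _ => if_neg (Ne.symm (hu σ))
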